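/- Let $\mathfrak g=\mathfrak g_{\bar 0}\oplus\mathfrak g_{\bar 1}$ be a finite dimensional complex Lie superalgebra with a non-degenerate bilinear form $(\cdot,\cdot)$ that is invariant, $([x,y],z)=(x,[y,z])$, consistent, $(\mathfrak g_{\bar 0},\mathfrak g_{\bar 1})=(\mathfrak g_{\bar 1},\mathfrak g_{\bar 0})=0$, and super-symmetric, $(x,y)=(-1)^{|x||y|}(y,x)$ for homogeneous $x,y$. Let $\mathfrak r\subset\mathfrak g$ be a (graded) subalgebra such that the restriction of $(\cdot,\cdot)$ to $\mathfrak r$ is non-degenerate, and let $\mathfrak p$ be the orthogonal complement of $\mathfrak r$, so that $\mathfrak g=\mathfrak r\oplus\mathfrak p$. Let $C(\mathfrak p)$ be the Clifford algebra, the quotient of the tensor algebra $T(\mathfrak p)$ by the relations $xy+(-1)^{|x||y|}yx=2(x,y)$, and $\Lambda(\mathfrak p)$ the exterior algebra, its quotient by the relations $x\wedge y+(-1)^{|x||y|}y\wedge x=0$ (for homogeneous $x,y\in\mathfrak p$). For homogeneous $x\in\mathfrak p$ let $\iota(x)$ be the derivation of degree $(-1,|x|)$ of $\Lambda(\mathfrak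 p)$ with $\iota(x)y=(x,y)$ for $y\in\mathfrak p$, extended linearly to all $x\in\mathfrak p$, and let $\gamma:C(\mathfrak p)\to\operatorname{End}\Lambda(\mathfrak p)$ be the algebra homomorphism with $\gamma(x)u=x\wedge u+\iota(x)u$ for $x\in\mathfrak p$. Identify $C(\mathfrak p)$ with $\Lambda(\mathfrak p)$ by the linear isomorphism $u\mapsto\gamma(u)1$. The enveloping algebra $U(\mathfrak g)$ and $C(\mathfrak p)$ are superalgebras, and $U(\mathfrak g)\otimes C(\mathfrak p)$ carries the product $(u\otimes v)(u'\otimes v')=(-1)^{|v||u'|}uu'\otimes vv'$. Let $\{y_i\}$ be a homogeneous basis of $\mathfrak p$ and $\{y^i\}$ its dual basis, $(y^i,y_j)=\delta_{ij}$. Put $$\phi_{\mathfrak p}=-\frac1{12}\sum_{i,j,k}(-1)^{|y_i||y_j|+|y_k||y_k|}([y_i,y_j],y_k)\,y^i\wedge y^j\wedge y^k\in\Lambda^3(\mathfrak p),\qquad D(\mathfrak g,\mathfrak r)=\sum_i y_i\otimes y^i+1\otimes\phi_{\mathfrak p}\in U(\mathfrak g)\otimes C(\mathfrak p).$$ Let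 $\mathrm{Cas}_{\mathfrak g}=\sum_i e_ie^i\in U(\mathfrak g)$ for any basis $\{e_i\}$ of $\mathfrak g$ and its dual basis $\{e^i\}$, $(e^i,e_j)=\delta_{ij}$, and define $\mathrm{Cas}_{\mathfrak r}\in U(\mathfrak r)$ in the same way. Let $\mathrm{ad}_{\mathfrak g}:U(\mathfrak g)\to\operatorname{End}(\mathfrak g)$ and $\mathrm{ad}_{\mathfrak r}:U(\mathfrak r)\to\operatorname{End}(\mathfrak r)$ be the extensions of the adjoint representations, and let $\mathrm{str}$ be the supertrace. Then there is a unique even linear map $\nu_*:\mathfrak r\to\Lambda^2(\mathfrak p)\subset C(\mathfrak p)$ that satisfies, for homogeneous $x,z\in\mathfrak r$ and $y\in\mathfrak p$, $\nu_*([x,z])=\nu_*(x)\nu_*(z)-(-1)^{|x||z|}\nu_*(z)\nu_*(x)$ and $\nu_*(x)y-(-1)^{|x||y|}y\nu_*(x)=[x,y]$ (products in $C(\mathfrak p)$). Let $\zeta:U(\mathfrak r)\to U(\mathfrak g)\otimes C(\mathfrak p)$ be the algebra homomorphism with $\zeta(x)=x\otimes1+1\otimes\nu_*(x)$ for $x\in\mathfrak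 r$. Then $$D(\mathfrak g,\mathfrak r)^2=\mathrm{Cas}_{\mathfrak g}\otimes1-\zeta(\mathrm{Cas}_{\mathfrak r})+\frac1{24}\bigl(\mathrm{str}\,\mathrm{ad}_{\mathfrak g}(\mathrm{Cas}_{\mathfrak g})-\mathrm{str}\,\mathrm{ad}_{\mathfrak r}(\mathrm{Cas}_{\mathfrak r})\bigr)(1\otimes1).$$ -/

import Mathlib

open scoped TensorProduct DirectSum

noncomputable section

namespace SuperDirac

/-! ### Super vector spaces -/

/-- A complex super vector space: a complex vector space with a `ℤ/2`-grading. -/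
class SuperSpace (V : Type*) [AddCommGroup V] [Module ℂ V] where
  /-- The even part `part 0` and the odd part `part 1`. -/
  part : ZMod 2 → Submodule ℂ V
  /-- `V` is the direct sum of its even and odd parts. -/
  isCompl : IsCompl (part 0) (part 1)

/-- The Koszul sign `(-1)^{ij}` of two parities `i`, `j`. -/
def ksign (i j : ZMod 2) : ℂ := (-1) ^ (i.val * j.val)

@[simp] theorem ksign_zero_left (j : ZMod 2) : ksign 0 j = 1 := by simp [ksign]
@[simp] theorem ksign_zero_right (j : ZMod 2) : ksign j 0 = 1 := by simp [ksign]
@[simp] theorem ksign_one_one : ksign 1 1 = -1 := by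
  have h : (1 : ZMod 2).val = 1 := rfl
  simp [ksign, h]

theorem zmod2_cases (i : ZMod 2) : i = 0 ∨ i = 1 := by revert i; decide

theorem ksign_comm (i j : ZMod 2) : ksign i j = ksign j i := by simp [ksign, mul_comm]

theorem ksign_add_right (i j k : ZMod 2) : ksign i (j + k) = ksign i j * ksign i k := by
  have h : (1 + 1 : ZMod 2) = 0 := rfl
  rcases zmod2_cases i with rfl | rfl <;> rcases zmod2_cases j with rfl | rfl <;>
    rcases zmod2_cases k with rfl | rfl <;> simp [h]

theorem ksign_mul_self (i j : ZMod 2) : ksign i j * ksign i j = 1 := by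
  rcases zmod2_cases i with rfl | rfl <;> rcases zmod2_cases j with rfl | rfl <;> simp

section SuperSpace

variable {V : Type*} [AddCommGroup V] [Module ℂ V] [SuperSpace V]

/-- The part of parity `i` of `V`. -/
abbrev part (i : ZMod 2) : Submodule ℂ V := SuperSpace.part i

theorem isCompl_part (i : ZMod 2) : IsCompl (part i : Submodule ℂ V) (part (i + 1)) := by
  rcases zmod2_cases i with rfl | rfl
  · exact SuperSpace.isCompl
  · exact SuperSpace.isCompl.symm

/-- The projection of a super vector space onto its part of parity `i`, along the other part. -/
def proj (i : ZMod 2) : V →ₗ[ℂ] V := (part i).projection (part (i + 1)) (isCompl_part i)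

theorem proj_mem (i : ZMod 2) (v : V) : proj i v ∈ (part i : Submodule ℂ V) :=
  Submodule.projection_apply_mem _ _

theorem proj_same {i : ZMod 2} {v : V} (hv : v ∈ (part i : Submodule ℂ V)) : proj i v = v :=
  Submodule.projection_apply_of_mem_left _ hv

theorem proj_ne {i j : ZMod 2} (h : i ≠ j) {v : V} (hv : v ∈ (part i : Submodule ℂ V)) :
    proj j v = 0 := by
  have H : ∀ i j : ZMod 2, i ≠ j → i = j + 1 := by decide
  have := H i j h
  subst this
  exact (Submodule.projection_apply_eq_zero_iff _).2 hv

theorem proj_add_proj (v : V) : proj 0 v + proj 1 v = v := by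
  obtain ⟨a, ha, b, hb, rfl⟩ := Submodule.mem_sup.1
    ((SuperSpace.isCompl (V := V)).sup_eq_top ▸ (Submodule.mem_top : v ∈ (⊤ : Submodule ℂ V)))
  rw [map_add, map_add, proj_same ha, proj_same hb, proj_ne (by decide) ha, proj_ne (by decide) hb]
  simp

/-- Two linear maps that agree on homogeneous elements are equal. -/
theorem linearMap_ext {M : Type*} [AddCommGroup M] [Module ℂ M] {f h : V →ₗ[ℂ] M}
    (H : ∀ i, ∀ v ∈ (part i : Submodule ℂ V), f v = h v) : f = h := by
  ext v
  rw [← proj_add_proj v, map_add, map_add, H 0 _ (proj_mem 0 v), H 1 _ (proj_mem 1 v)]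

/-- The supertrace: the trace of the diagonal even block minus the trace of the diagonal odd
block. -/
def supertrace (T : V →ₗ[ℂ] V) : ℂ :=
  LinearMap.trace ℂ V (proj 0 ∘ₗ T ∘ₗ proj 0) - LinearMap.trace ℂ V (proj 1 ∘ₗ T ∘ₗ proj 1)

/-- The linear map that multiplies a vector of parity `j` by `(-1)^{ij}`. -/
def signMap (i : ZMod 2) : V →ₗ[ℂ] V := proj 0 + ksign i 1 • proj 1

theorem signMap_apply {i j : ZMod 2} {v : V} (hv : v ∈ (part j : Submodule ℂ V)) :
    signMap i v = ksign i j • v := by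
  rcases zmod2_cases j with rfl | rfl
  · simp [signMap, proj_same hv, proj_ne (by decide : (0 : ZMod 2) ≠ 1) hv]
  · simp [signMap, proj_same hv, proj_ne (by decide : (1 : ZMod 2) ≠ 0) hv]

end SuperSpace

/-- A subspace is a super subspace if it contains the homogeneous components of its elements. -/
class IsSuperSubspace {V : Type*} [AddCommGroup V] [Module ℂ V] [SuperSpace V]
    (W : Submodule ℂ V) : Prop where
  proj_mem : ∀ i, ∀ v ∈ W, proj i v ∈ W

/-- A super subspace is a super vector space, with parts `W ∩ V₀` and `W ∩ V₁`. -/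
instance subSuperSpace {V : Type*} [AddCommGroup V] [Module ℂ V] [SuperSpace V]
    (W : Submodule ℂ V) [IsSuperSubspace W] : SuperSpace W where
  part i := (part i).comap W.subtype
  isCompl := by
    constructor
    · rw [Submodule.disjoint_def]
      rintro ⟨x, hx⟩ h0 h1
      ext
      exact Submodule.disjoint_def.1 (SuperSpace.isCompl (V := V)).disjoint x h0 h1
    · rw [codisjoint_iff, Submodule.eq_top_iff']
      rintro ⟨x, hx⟩
      refine Submodule.mem_sup.2 ⟨⟨proj 0 x, IsSuperSubspace.proj_mem 0 x hx⟩, proj_mem 0 x,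
        ⟨proj 1 x, IsSuperSubspace.proj_mem 1 x hx⟩, proj_mem 1 x, ?_⟩
      ext
      exact proj_add_proj x

/-! ### The `ℤ/2`-grading of an algebra generated by a super vector space -/

section Monomials

variable {V A : Type*} [AddCommGroup V] [Module ℂ V] [SuperSpace V] [Ring A] [Algebra ℂ A]

/-- `IsMonomial f i u`: the element `u` is a product `f x₁ * ⋯ * f xₙ` (`n ≥ 0`) with homogeneous
`x₁, …, xₙ` whose parities add up to `i`. -/
inductive IsMonomial (f : V →ₗ[ℂ] A) : ZMod 2 → A → Prop
  | one : IsMonomial f 0 1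
  | cons {i j : ZMod 2} {x : V} {u : A} (hx : x ∈ (part i : Submodule ℂ V))
      (hu : IsMonomial f j u) : IsMonomial f (i + j) (f x * u)

/-- The span of the monomials of parity `i`. -/
def monomialPart (f : V →ₗ[ℂ] A) (i : ZMod 2) : Submodule ℂ A :=
  Submodule.span ℂ {u | IsMonomial f i u}

theorem IsMonomial.mul {f : V →ₗ[ℂ] A} {i j : ZMod 2} {u v : A} (hu : IsMonomial f i u)
    (hv : IsMonomial f j v) : IsMonomial f (i + j) (u * v) := by
  induction hu with
  | one => simpa using hv
  | cons hx _ ih => rw [mul_assoc, add_assoc]; exact .cons hx ih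

theorem mem_monomialPart (f : V →ₗ[ℂ] A) {i : ZMod 2} {x : V}
    (hx : x ∈ (part i : Submodule ℂ V)) : f x ∈ monomialPart f i := by
  have h := Submodule.subset_span (R := ℂ) (IsMonomial.cons hx (IsMonomial.one (f := f)))
  rwa [add_zero, mul_one] at h

instance monomialPart_gradedMonoid (f : V →ₗ[ℂ] A) : SetLike.GradedMonoid (monomialPart f) where
  one_mem := Submodule.subset_span .one
  mul_mem i j u v hu hv := by
    have h : monomialPart f i * monomialPart f j ≤ monomialPart f (i + j) := by
      rw [monomialPart, monomialPart, Submodule.span_mul_span]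
      apply Submodule.span_mono
      rintro _ ⟨a, ha, b, hb, rfl⟩
      exact ha.mul hb
    exact h (Submodule.mul_mem_mul hu hv)

/-- If `A` is generated by `f` and has an automorphism acting by `(-1)^i` on `f x` for `x` of
parity `i`, then the spans of the even and of the odd monomials grade `A`. -/
abbrev monomialGradedAlgebra (f : V →ₗ[ℂ] A) (θ : A →ₐ[ℂ] A)
    (hθ : ∀ i, ∀ x ∈ (part i : Submodule ℂ V), θ (f x) = ksign 1 i • f x)
    (hf : Algebra.adjoin ℂ (Set.range f) = ⊤) : GradedAlgebra (monomialPart f) :=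
  have key : ∀ i, ∀ u ∈ monomialPart f i, θ u = ksign 1 i • u := by
    intro i u hu
    induction hu using Submodule.span_induction with
    | mem u hu =>
      induction hu with
      | one => simp
      | cons hx _ ih => rw [map_mul, hθ _ _ hx, ih, ksign_add_right, smul_mul_smul_comm]
    | zero => simp
    | add _ _ _ _ h1 h2 => rw [map_add, h1, h2, smul_add]
    | smul c _ _ h => rw [map_smul, h, smul_comm]
  have hcompl : IsCompl (monomialPart f 0) (monomialPart f 1) := by
    constructor
    · rw [Submodule.disjoint_def]
      intro u h0 h1
      have e0 := key 0 u h0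
      have e1 := key 1 u h1
      simp only [ksign_zero_right, one_smul, ksign_one_one, neg_smul] at e0 e1
      have e2 : (2 : ℂ) • u = 0 := by
        rw [two_smul]; nth_rewrite 1 [e0.symm.trans e1]; simp
      exact (smul_eq_zero.1 e2).resolve_left two_ne_zero
    · rw [codisjoint_iff, Submodule.eq_top_iff']
      intro u
      have hu : u ∈ Algebra.adjoin ℂ (Set.range f) := hf ▸ Algebra.mem_top
      have hone : (1 : A) ∈ monomialPart f 0 := SetLike.GradedOne.one_mem
      have hmul : ∀ i j, ∀ a ∈ monomialPart f i, ∀ b ∈ monomialPart f j,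
          a * b ∈ monomialPart f 0 ⊔ monomialPart f 1 := by
        intro i j a ha b hb
        have h := SetLike.GradedMul.mul_mem ha hb
        rcases zmod2_cases (i + j) with e | e <;> rw [e] at h
        · exact Submodule.mem_sup_left h
        · exact Submodule.mem_sup_right h
      induction hu using Algebra.adjoin_induction with
      | mem x hx =>
        obtain ⟨v, rfl⟩ := hx
        rw [← proj_add_proj v, map_add]
        exact Submodule.add_mem_sup (mem_monomialPart f (proj_mem 0 v))
          (mem_monomialPart f (proj_mem 1 v))
      | algebraMap r =>
        rw [Algebra.algebraMap_eq_smul_one]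
        exact Submodule.smul_mem _ _ (Submodule.mem_sup_left hone)
      | add _ _ _ _ h1 h2 => exact Submodule.add_mem _ h1 h2
      | mul x y _ _ h1 h2 =>
        obtain ⟨a, ha, b, hb, rfl⟩ := Submodule.mem_sup.1 h1
        obtain ⟨c, hc, d, hd, rfl⟩ := Submodule.mem_sup.1 h2
        rw [add_mul, mul_add, mul_add]
        exact add_mem (add_mem (hmul _ _ _ ha _ hc) (hmul _ _ _ ha _ hd))
          (add_mem (hmul _ _ _ hb _ hc) (hmul _ _ _ hb _ hd))
  { (DirectSum.IsInternal.chooseDecomposition _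
      ((DirectSum.isInternal_submodule_iff_isCompl _ (zero_ne_one)
        (by ext i; rcases zmod2_cases i with rfl | rfl <;> simp)).2 hcompl)),
    monomialPart_gradedMonoid f with }

end Monomials

/-! ### Super-symmetric bilinear forms and orthogonal complements -/

/-- A consistent super-symmetric bilinear form on a super vector space. -/
structure SuperForm (V : Type*) [AddCommGroup V] [Module ℂ V] [SuperSpace V] where
  /-- The underlying bilinear form. -/
  toBilin : LinearMap.BilinForm ℂ V
  consistent : ∀ i j, i ≠ j → ∀ x ∈ (part i : Submodule ℂ V), ∀ y ∈ (part j : Submodule ℂ V),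
    toBilin x y = 0
  supersymm : ∀ i j, ∀ x ∈ (part i : Submodule ℂ V), ∀ y ∈ (part j : Submodule ℂ V),
    toBilin x y = ksign i j * toBilin y x

section SuperForm

variable {V : Type*} [AddCommGroup V] [Module ℂ V] [SuperSpace V]

/-- The zero form. -/
def SuperForm.zero (V : Type*) [AddCommGroup V] [Module ℂ V] [SuperSpace V] : SuperForm V where
  toBilin := 0
  consistent := by simp
  supersymm := by simp

/-- The negative of a form. -/
def SuperForm.neg (β : SuperForm V) : SuperForm V where
  toBilin := -β.toBilin
  consistent i j h x hx y hy := by simp [β.consistent i j h x hx y hy]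
  supersymm i j x hx y hy := by simp [β.supersymm i j x hx y hy]

/-- The restriction of a form to a super subspace. -/
def SuperForm.restrict (β : SuperForm V) (W : Submodule ℂ V) [IsSuperSubspace W] :
    SuperForm W where
  toBilin := β.toBilin.restrict W
  consistent i j h x hx y hy := β.consistent i j h x hx y hy
  supersymm i j x hx y hy := β.supersymm i j x hx y hy

/-- The orthogonal complement `{y | (x, y) = 0 for all x ∈ W}`. -/
def perp (β : SuperForm V) (W : Submodule ℂ V) : Submodule ℂ V := β.toBilin.orthogonal W

theorem mem_perp {β : SuperForm V} {W : Submodule ℂ V} {y : V} :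
    y ∈ perp β W ↔ ∀ x ∈ W, β.toBilin x y = 0 := Iff.rfl

theorem SuperForm.apply_proj (β : SuperForm V) (i : ZMod 2) (x y : V) :
    β.toBilin x (proj i y) = β.toBilin (proj i x) y := by
  have h01 := β.consistent 0 1 (by decide) _ (proj_mem 0 x) _ (proj_mem 1 y)
  have h10 := β.consistent 1 0 (by decide) _ (proj_mem 1 x) _ (proj_mem 0 y)
  rcases zmod2_cases i with rfl | rfl
  · conv_lhs => rw [← proj_add_proj x]
    conv_rhs => rw [← proj_add_proj y]
    simp [h01, h10]
  · conv_lhs => rw [← proj_add_proj x]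
    conv_rhs => rw [← proj_add_proj y]
    simp [h01, h10]

instance (β : SuperForm V) (W : Submodule ℂ V) [IsSuperSubspace W] :
    IsSuperSubspace (perp β W) where
  proj_mem i y hy := by
    rw [mem_perp] at hy ⊢
    intro x hx
    rw [β.apply_proj]
    exact hy _ (IsSuperSubspace.proj_mem i x hx)

/-- The family `b'` is dual to the family `b` with respect to the form: `(b' i, b j) = δᵢⱼ`. -/
def SuperForm.IsDual (β : SuperForm V) {ι : Type*} [DecidableEq ι] (b b' : ι → V) : Prop :=
  ∀ i j, β.toBilin (b' i) (b j) = if i = j then 1 else 0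

end SuperForm

/-! ### Clifford and exterior algebras -/

/-- The relations `x ⊗ y + (-1)^{|x||y|} y ⊗ x = 2 (x, y)` for homogeneous `x`, `y`. -/
inductive CliffordRel {V : Type*} [AddCommGroup V] [Module ℂ V] [SuperSpace V] (β : SuperForm V) :
    TensorAlgebra ℂ V → TensorAlgebra ℂ V → Prop
  | mk {i j : ZMod 2} {x y : V} (hx : x ∈ (part i : Submodule ℂ V))
      (hy : y ∈ (part j : Submodule ℂ V)) :
      CliffordRel β (TensorAlgebra.ι ℂ x * TensorAlgebra.ι ℂ y +
          ksign i j • (TensorAlgebra.ι ℂ y * TensorAlgebra.ι ℂ x))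
        (algebraMap ℂ _ (2 * β.toBilin x y))

/-- The Clifford algebra of a super vector space with a super-symmetric form: the quotient of the
tensor algebra by the relations `x y + (-1)^{|x||y|} y x = 2 (x, y)`. -/
def SuperClifford {V : Type*} [AddCommGroup V] [Module ℂ V] [SuperSpace V] (β : SuperForm V) :
    Type _ := RingQuot (CliffordRel β)

instance {V : Type*} [AddCommGroup V] [Module ℂ V] [SuperSpace V] (β : SuperForm V) :
    Ring (SuperClifford β) := inferInstanceAs (Ring (RingQuot (CliffordRel β)))

instance {V : Type*} [AddCommGroup V] [Module ℂ V] [SuperSpace V] (β : SuperForm V) :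
    Algebra ℂ (SuperClifford β) := inferInstanceAs (Algebra ℂ (RingQuot (CliffordRel β)))

/-- The exterior algebra of a super vector space: the quotient of the tensor algebra by the
relations `x ∧ y + (-1)^{|x||y|} y ∧ x = 0`. -/
abbrev SuperExterior (V : Type*) [AddCommGroup V] [Module ℂ V] [SuperSpace V] : Type _ :=
  SuperClifford (SuperForm.zero V)

namespace SuperClifford

variable {V : Type*} [AddCommGroup V] [Module ℂ V] [SuperSpace V] (β : SuperForm V)

/-- The quotient map from the tensor algebra to the Clifford algebra. -/
def mk : TensorAlgebra ℂ V →ₐ[ℂ] SuperClifford β := RingQuot.mkAlgHom ℂ (CliffordRel β)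

theorem mk_surjective : Function.Surjective (mk β) := RingQuot.mkAlgHom_surjective ℂ _

/-- The canonical map from `V` to its Clifford algebra. -/
def ι : V →ₗ[ℂ] SuperClifford β := (mk β).toLinearMap ∘ₗ TensorAlgebra.ι ℂ

theorem ι_rel {i j : ZMod 2} {x y : V} (hx : x ∈ (part i : Submodule ℂ V))
    (hy : y ∈ (part j : Submodule ℂ V)) :
    ι β x * ι β y + ksign i j • (ι β y * ι β x) = algebraMap ℂ _ (2 * β.toBilin x y) := by
  have h : mk β _ = mk β _ := RingQuot.mkAlgHom_rel ℂ (CliffordRel.mk (β := β) hx hy)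
  rw [map_add, map_mul, map_smul, map_mul, AlgHom.commutes] at h
  exact h

variable {A : Type*} [Ring A] [Algebra ℂ A]

/-- The universal property of the Clifford algebra. -/
def lift (f : V →ₗ[ℂ] A)
    (hf : ∀ i j, ∀ x ∈ (part i : Submodule ℂ V), ∀ y ∈ (part j : Submodule ℂ V),
      f x * f y + ksign i j • (f y * f x) = algebraMap ℂ A (2 * β.toBilin x y)) :
    SuperClifford β →ₐ[ℂ] A :=
  RingQuot.liftAlgHom ℂ ⟨TensorAlgebra.lift ℂ f, by
    rintro _ _ ⟨hx, hy⟩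
    simpa using hf _ _ _ hx _ hy⟩

@[simp] theorem lift_ι (f : V →ₗ[ℂ] A) (hf) (x : V) : lift β f hf (ι β x) = f x := by
  have h := RingQuot.liftAlgHom_mkAlgHom_apply ℂ (TensorAlgebra.lift ℂ f)
    (s := CliffordRel β) (by rintro _ _ ⟨hx, hy⟩; simpa using hf _ _ _ hx _ hy)
    (TensorAlgebra.ι ℂ x)
  rw [TensorAlgebra.lift_ι_apply] at h
  exact h

/-- Induction for the equality of two linear maps on a Clifford algebra. -/
theorem linearMap_ext' {M : Type*} [AddCommGroup M] [Module ℂ M] {F G : SuperClifford β →ₗ[ℂ] M}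
    (h1 : F 1 = G 1)
    (hmul : ∀ i, ∀ x ∈ (part i : Submodule ℂ V), ∀ u, F u = G u → F (ι β x * u) = G (ι β x * u)) :
    F = G := by
  have hmul' : ∀ x u, F u = G u → F (ι β x * u) = G (ι β x * u) := by
    intro x u hu
    rw [← proj_add_proj x, map_add, add_mul, map_add, map_add, hmul 0 _ (proj_mem 0 x) u hu,
      hmul 1 _ (proj_mem 1 x) u hu]
  have key : ∀ a : TensorAlgebra ℂ V, ∀ u, F u = G u →
      F (mk β a * u) =
        G (mk β a * u) := by
    intro a
    induction a using TensorAlgebra.induction with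
    | algebraMap r => intro u hu; simp [Algebra.algebraMap_eq_smul_one, hu]
    | ι x => exact hmul' x
    | mul a b ha hb => intro u hu; rw [map_mul (mk β), mul_assoc]; exact ha _ (hb u hu)
    | add a b ha hb => intro u hu; rw [map_add, add_mul, map_add, map_add, ha u hu, hb u hu]
  ext u
  obtain ⟨a, rfl⟩ := mk_surjective β u
  simpa using key a 1 h1

theorem adjoin_range_ι : Algebra.adjoin ℂ (Set.range (ι β)) = ⊤ := by
  rw [ι, LinearMap.coe_comp, Set.range_comp, AlgHom.coe_toLinearMap, ← AlgHom.map_adjoin,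
    TensorAlgebra.adjoin_range_ι, Algebra.map_top, AlgHom.range_eq_top]
  exact mk_surjective β

/-- The parity automorphism, `x ↦ (-1)^{|x|} x` for homogeneous `x ∈ V`. -/
def parityHom : SuperClifford β →ₐ[ℂ] SuperClifford β :=
  lift β (ι β ∘ₗ signMap 1) (by
    intro i j x hx y hy
    simp only [LinearMap.comp_apply, signMap_apply hx, signMap_apply hy, map_smul]
    rw [smul_mul_smul_comm, smul_mul_smul_comm, smul_comm, mul_comm (ksign 1 j), ← smul_add,
      ι_rel β hx hy]
    rcases eq_or_ne i j with rfl | h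
    · rw [ksign_mul_self, one_smul]
    · simp [β.consistent i j h x hx y hy])

/-- The `ℤ/2`-grading of the Clifford algebra that is inherited from the tensor algebra. -/
def grading (i : ZMod 2) : Submodule ℂ (SuperClifford β) := monomialPart (ι β) i

instance : GradedAlgebra (grading β) :=
  monomialGradedAlgebra (ι β) (parityHom β)
    (by intro i x hx; simp [parityHom, signMap_apply hx]) (adjoin_range_ι β)

/-! ### Contractions and the identification of the Clifford algebra with the exterior algebra -/

/-- The algebra automorphism `y ↦ -(-1)^{k|y|} y`, by which a derivation of degree `(-1, k)`
is twisted. -/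
def twist (k : ZMod 2) : SuperClifford β →ₐ[ℂ] SuperClifford β :=
  lift β (-(ι β ∘ₗ signMap k)) (by
    intro i j x hx y hy
    simp only [LinearMap.neg_apply, LinearMap.comp_apply, signMap_apply hx, signMap_apply hy,
      map_smul, neg_mul_neg]
    rw [smul_mul_smul_comm, smul_mul_smul_comm, smul_comm, mul_comm (ksign k j), ← smul_add,
      ι_rel β hx hy]
    rcases eq_or_ne i j with rfl | h
    · rw [ksign_mul_self, one_smul]
    · simp [β.consistent i j h x hx y hy])

/-- For a linear functional `f`, the algebra homomorphism whose value at `u` is the matrix with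
rows `(u', d u)` and `(0, u)`, where `u'` is the twist of `u` and `d` is the derivation of degree
`(-1, k)` with `d y = f y` for `y` of parity `k` and `d y = 0` for `y` of the other parity. -/
def contractHom (k : ZMod 2) (f : V →ₗ[ℂ] ℂ) :
    SuperClifford β →ₐ[ℂ] Matrix (Fin 2) (Fin 2) (SuperClifford β) :=
  lift β
    { toFun := fun y => !![twist β k (ι β y), algebraMap ℂ _ (f (proj k y)); 0, ι β y]
      map_add' := fun y z => by
        ext a b; fin_cases a <;> fin_cases b <;> simp
      map_smul' := fun c y => by
        ext a b; fin_cases a <;> fin_cases b <;> simp [Algebra.smul_def] }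
    (by
      intro i j x hx y hy
      have h1 := ι_rel β hx hy
      have h2 := congrArg (twist β k) h1
      rw [map_add, map_smul, map_mul, map_mul, AlgHom.commutes] at h2
      have h3 : twist β k (ι β x) = -(ksign k i • ι β x) := by simp [twist, signMap_apply hx]
      have h4 : twist β k (ι β y) = -(ksign k j • ι β y) := by simp [twist, signMap_apply hy]
      have hoff : twist β k (ι β x) * algebraMap ℂ _ (f (proj k y)) +
          f (proj k x) • ι β y + ksign i j •
          (twist β k (ι β y) * algebraMap ℂ _ (f (proj k x)) +
            f (proj k y) • ι β x) = 0 := by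
        rw [h3, h4, ← Algebra.commutes (f (proj k y)), ← Algebra.commutes (f (proj k x))]
        simp only [← Algebra.smul_def]
        have ha : (ksign i j - ksign k i) * f (proj k y) = 0 := by
          rcases eq_or_ne j k with rfl | h
          · rw [ksign_comm, sub_self, zero_mul]
          · rw [proj_ne h hy, map_zero, mul_zero]
        have hb : (1 - ksign i j * ksign k j) * f (proj k x) = 0 := by
          rcases eq_or_ne i k with rfl | h
          · rw [ksign_mul_self, sub_self, zero_mul]
          · rw [proj_ne h hx, map_zero, mul_zero]
        have : (f (proj k y)) • -(ksign k i • ι β x) + f (proj k x) • ι β y +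
            ksign i j • (f (proj k x) • -(ksign k j • ι β y) + f (proj k y) • ι β x) =
            ((ksign i j - ksign k i) * f (proj k y)) • ι β x +
            ((1 - ksign i j * ksign k j) * f (proj k x)) • ι β y := by
          module
        rw [this, ha, hb, zero_smul, zero_smul, add_zero]
      ext a b
      fin_cases a <;> fin_cases b
      · simpa [Matrix.algebraMap_matrix_apply] using h2
      · simpa [Matrix.algebraMap_matrix_apply] using hoff
      · simp [Matrix.algebraMap_matrix_apply]
      · simpa [Matrix.algebraMap_matrix_apply] using h1)

/-- The derivation `d` of degree `(-1, k)` of the Clifford algebra with `d y = f y` for `y ∈ V` of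
parity `k` and `d y = 0` for `y ∈ V` of the other parity. -/
def contractPart (k : ZMod 2) (f : V →ₗ[ℂ] ℂ) : SuperClifford β →ₗ[ℂ] SuperClifford β :=
  LinearMap.proj 1 ∘ₗ LinearMap.proj 0 ∘ₗ
    (Matrix.ofLinearEquiv ℂ).symm.toLinearMap ∘ₗ (contractHom β k f).toLinearMap

theorem contractPart_apply (k : ZMod 2) (f : V →ₗ[ℂ] ℂ) (u : SuperClifford β) :
    contractPart β k f u = contractHom β k f u 0 1 := rfl

theorem contractHom_ι (k : ZMod 2) (f : V →ₗ[ℂ] ℂ) (y : V) : contractHom β k f (ι β y) =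
    !![twist β k (ι β y), algebraMap ℂ _ (f (proj k y)); 0, ι β y] := by
  rw [contractHom, lift_ι]; rfl

theorem contractHom_one_one (k : ZMod 2) (f : V →ₗ[ℂ] ℂ) (u : SuperClifford β) :
    contractHom β k f u 1 1 = u := by
  have h : LinearMap.proj 1 ∘ₗ LinearMap.proj 1 ∘ₗ
    (Matrix.ofLinearEquiv ℂ).symm.toLinearMap ∘ₗ (contractHom β k f).toLinearMap =
      (LinearMap.id : SuperClifford β →ₗ[ℂ] SuperClifford β) := by
    apply linearMap_ext'
    · change contractHom β k f 1 1 1 = 1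
      rw [map_one, Matrix.one_apply_eq]
    · intro i x _ u hu
      change contractHom β k f u 1 1 = u at hu
      change contractHom β k f (ι β x * u) 1 1 = ι β x * u
      rw [map_mul, contractHom_ι, Matrix.mul_apply, Fin.sum_univ_two, hu]
      simp
  exact LinearMap.congr_fun h u

theorem contractPart_one (k : ZMod 2) (f : V →ₗ[ℂ] ℂ) : contractPart β k f 1 = 0 := by
  rw [contractPart_apply, map_one, Matrix.one_apply_ne (by decide)]

theorem contractPart_ι_mul (k : ZMod 2) (f : V →ₗ[ℂ] ℂ) {j : ZMod 2} {y : V}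
    (hy : y ∈ (part j : Submodule ℂ V)) (u : SuperClifford β) :
    contractPart β k f (ι β y * u) =
      f (proj k y) • u - ksign k j • (ι β y * contractPart β k f u) := by
  rw [contractPart_apply, contractPart_apply, map_mul, contractHom_ι, Matrix.mul_apply,
    Fin.sum_univ_two, contractHom_one_one]
  have h4 : twist β k (ι β y) = -(ksign k j • ι β y) := by simp [twist, signMap_apply hy]
  simp only [Matrix.of_apply, Matrix.cons_val_zero, Matrix.cons_val_one,
    Matrix.cons_val_fin_one, h4]
  rw [neg_mul, smul_mul_assoc, ← Algebra.smul_def]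
  abel

/-- `contractPart`, as a linear map in the functional. -/
def contractPartLin (k : ZMod 2) :
    (V →ₗ[ℂ] ℂ) →ₗ[ℂ] (SuperClifford β →ₗ[ℂ] SuperClifford β) where
  toFun f := contractPart β k f
  map_add' f g := by
    apply linearMap_ext'
    · simp [contractPart_one]
    · intro j y hy u hu
      rw [LinearMap.add_apply] at hu ⊢
      rw [contractPart_ι_mul β k _ hy, contractPart_ι_mul β k _ hy, contractPart_ι_mul β k _ hy, hu,
        LinearMap.add_apply, mul_add]
      module
  map_smul' c f := by
    apply linearMap_ext'
    · simp [contractPart_one]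
    · intro j y hy u hu
      rw [RingHom.id_apply, LinearMap.smul_apply] at hu ⊢
      rw [contractPart_ι_mul β k _ hy, contractPart_ι_mul β k _ hy, hu, LinearMap.smul_apply,
        mul_smul_comm, smul_eq_mul]
      module

/-- The contraction `ι(x)` with `x ∈ V` with respect to a form `α` on `V`: for homogeneous `x`, the
derivation of degree `(-1, |x|)` of the Clifford algebra with `ι(x) y = α(x, y)` for `y ∈ V`. -/
def contract (α : SuperForm V) : V →ₗ[ℂ] (SuperClifford β →ₗ[ℂ] SuperClifford β) :=
  contractPartLin β 0 ∘ₗ α.toBilin + contractPartLin β 1 ∘ₗ α.toBilin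

theorem contract_one (α : SuperForm V) (x : V) : contract β α x 1 = 0 := by
  simp [contract, contractPartLin, contractPart_one]

theorem contractPart_eq_zero (α : SuperForm V) {i k : ZMod 2} (h : i ≠ k) {x : V}
    (hx : x ∈ (part i : Submodule ℂ V)) : contractPart β k (α.toBilin x) = 0 := by
  apply linearMap_ext'
  · simp [contractPart_one]
  · intro j y hy u hu
    rw [contractPart_ι_mul β k _ hy, hu, α.consistent i k h x hx _ (proj_mem k y)]
    simp

theorem contract_eq (α : SuperForm V) {i : ZMod 2} {x : V}
    (hx : x ∈ (part i : Submodule ℂ V)) :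
    contract β α x = contractPart β i (α.toBilin x) := by
  rcases zmod2_cases i with rfl | rfl
  · have h := contractPart_eq_zero β α (k := 1) (by decide) hx
    change contractPart β 0 _ + contractPart β 1 _ = _
    rw [h, add_zero]
  · have h := contractPart_eq_zero β α (k := 0) (by decide) hx
    change contractPart β 0 _ + contractPart β 1 _ = _
    rw [h, zero_add]

theorem contract_ι_mul (α : SuperForm V) {i j : ZMod 2} {x y : V}
    (hx : x ∈ (part i : Submodule ℂ V)) (hy : y ∈ (part j : Submodule ℂ V))
    (u : SuperClifford β) :
    contract β α x (ι β y * u) =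
      α.toBilin x y • u - ksign i j • (ι β y * contract β α x u) := by
  rw [contract_eq β α hx, contractPart_ι_mul β i _ hy]
  rcases eq_or_ne j i with rfl | h
  · rw [proj_same hy]
  · rw [proj_ne h hy, map_zero, α.consistent i j h.symm x hx y hy]

theorem contract_anticomm (α : SuperForm V) {i j : ZMod 2} {x y : V}
    (hx : x ∈ (part i : Submodule ℂ V)) (hy : y ∈ (part j : Submodule ℂ V))
    (u : SuperClifford β) :
    contract β α x (contract β α y u) + ksign i j • contract β α y (contract β α x u) = 0 := by
  have h : contract β α x ∘ₗ contract β α y + ksign i j • (contract β α y ∘ₗ contract β α x) =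
      0 := by
    apply linearMap_ext'
    · simp [contract_one]
    · intro k z hz u hu
      simp only [LinearMap.add_apply, LinearMap.smul_apply, LinearMap.comp_apply,
        LinearMap.zero_apply] at hu ⊢
      rw [contract_ι_mul β α hy hz, contract_ι_mul β α hx hz, map_sub, map_sub, map_smul, map_smul,
        map_smul, map_smul, contract_ι_mul β α hy hz, contract_ι_mul β α hx hz]
      have ha : (1 - ksign i j * ksign i k) * α.toBilin y z = 0 := by
        rcases eq_or_ne j k with rfl | h
        · rw [ksign_mul_self, sub_self, zero_mul]
        · rw [α.consistent j k h y hy z hz, mul_zero]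
      have hb : (ksign i j - ksign j k) * α.toBilin x z = 0 := by
        rcases eq_or_ne i k with rfl | h
        · rw [ksign_comm, sub_self, zero_mul]
        · rw [α.consistent i k h x hx z hz, mul_zero]
      have hu' := congrArg (fun w => (ksign i k * ksign j k) • (ι β z * w)) hu
      simp only [mul_add, mul_smul_comm, mul_zero, smul_zero] at hu'
      linear_combination (norm := module) hu' + congrArg (fun c : ℂ => c • contract β α x u) ha +
        congrArg (fun c : ℂ => c • contract β α y u) hb
  exact LinearMap.congr_fun h u

/-- Left Clifford multiplication by `x ∈ V` plus contraction with `x` with respect to `α`. -/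
def gammaLin (α : SuperForm V) : V →ₗ[ℂ] Module.End ℂ (SuperClifford β) :=
  (LinearMap.mul ℂ (SuperClifford β)) ∘ₗ ι β + contract β α

theorem gammaLin_apply (α : SuperForm V) (x : V) (u : SuperClifford β) :
    gammaLin β α x u = ι β x * u + contract β α x u := rfl

/-- If `β' = β + α`, the action of the Clifford algebra of `β'` on the Clifford algebra of `β` in
which `x ∈ V` acts as left multiplication by `x` plus contraction with `x` with respect to `α`. -/
def gamma (β' α : SuperForm V) (h : ∀ x y, β'.toBilin x y = β.toBilin x y + α.toBilin x y) :
    SuperClifford β' →ₐ[ℂ] Module.End ℂ (SuperClifford β) :=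
  lift β' (gammaLin β α) (by
    intro i j x hx y hy
    ext u
    have h1 := congrArg (· * u) (ι_rel β hx hy)
    have h2 := contract_anticomm β α hx hy u
    simp only [add_mul, smul_mul_assoc, mul_assoc, ← Algebra.smul_def] at h1
    rw [LinearMap.add_apply, LinearMap.smul_apply, Module.End.mul_apply, Module.End.mul_apply,
      gammaLin_apply, gammaLin_apply, gammaLin_apply, gammaLin_apply, map_add, map_add,
      contract_ι_mul β α hx hy, contract_ι_mul β α hy hx, mul_add, mul_add,
      Module.algebraMap_end_apply, h, α.supersymm j i y hy x hx, ksign_comm j i]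
    have h3 := ksign_mul_self i j
    have h4 := congrArg (fun c : ℂ => (c * α.toBilin x y) • u) h3
    have h5 := congrArg (fun c : ℂ => c • (ι β x * contract β α y u)) h3
    linear_combination (norm := module) h1 + h2 + h4 - h5)

/-- If `β' = β + α`, the linear map `u ↦ γ(u) 1` from the Clifford algebra of `β'` to the Clifford
algebra of `β`. -/
def changeForm (β' α : SuperForm V)
    (h : ∀ x y, β'.toBilin x y = β.toBilin x y + α.toBilin x y) :
    SuperClifford β' →ₗ[ℂ] SuperClifford β :=
  LinearMap.applyₗ 1 ∘ₗ (gamma β β' α h).toLinearMap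

section changeForm

variable {β} {β' α : SuperForm V} (h : ∀ x y, β'.toBilin x y = β.toBilin x y + α.toBilin x y)

theorem changeForm_one : changeForm β β' α h 1 = 1 := by
  change gamma β β' α h 1 1 = 1
  rw [map_one (gamma β β' α h)]
  rfl

theorem changeForm_ι_mul (x : V) (u : SuperClifford β') :
    changeForm β β' α h (ι β' x * u) =
      ι β x * changeForm β β' α h u + contract β α x (changeForm β β' α h u) := by
  change gamma β β' α h (ι β' x * u) 1 = _
  rw [map_mul, Module.End.mul_apply, gamma, lift_ι, gammaLin_apply]
  rfl

theorem changeForm_contract {i : ZMod 2} {x : V}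
    (hx : x ∈ (part i : Submodule ℂ V))
    (u : SuperClifford β') :
    changeForm β β' α h (contract β' α x u) = contract β α x (changeForm β β' α h u) := by
  have H : changeForm β β' α h ∘ₗ contract β' α x = contract β α x ∘ₗ changeForm β β' α h := by
    apply linearMap_ext'
    · simp [contract_one, changeForm_one]
    · intro j y hy u hu
      simp only [LinearMap.comp_apply] at hu ⊢
      rw [contract_ι_mul β' α hx hy, map_sub, map_smul, map_smul, changeForm_ι_mul,
        changeForm_ι_mul, map_add, contract_ι_mul β α hx hy, hu]
      have h2 := contract_anticomm β α hx hy (changeForm β β' α h u)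
      linear_combination (norm := module) -h2
  exact LinearMap.congr_fun H u

theorem contract_neg (α : SuperForm V) (x : V) : contract β α.neg x = -contract β α x := by
  change contractPartLin β 0 (-α.toBilin x) + contractPartLin β 1 (-α.toBilin x) =
    -(contractPartLin β 0 (α.toBilin x) + contractPartLin β 1 (α.toBilin x))
  rw [map_neg, map_neg, neg_add]

theorem changeForm_changeForm (h' : ∀ x y, β.toBilin x y = β'.toBilin x y + α.neg.toBilin x y)
    (u : SuperClifford β') :
    changeForm β' β α.neg h' (changeForm β β' α h u) = u := by
  have H : changeForm β' β α.neg h' ∘ₗ changeForm β β' α h = LinearMap.id := by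
    apply linearMap_ext'
    · simp [changeForm_one]
    · intro j y hy u hu
      simp only [LinearMap.comp_apply, LinearMap.id_apply] at hu ⊢
      have h2 := changeForm_contract h' hy (changeForm β β' α h u)
      rw [contract_neg, LinearMap.neg_apply, map_neg] at h2
      rw [changeForm_ι_mul, map_add, changeForm_ι_mul, hu]
      rw [hu] at h2
      linear_combination (norm := module) -h2
  exact LinearMap.congr_fun H u

end changeForm

/-- The linear isomorphism `η : C(V) → Λ(V)`, `η(u) = γ(u) 1`, where `x ∈ V` acts on `Λ(V)` by
`γ(x) = ε(x) + ι(x)`, the sum of the exterior multiplication by `x` and the contraction with `x`.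
It identifies the Clifford algebra with the exterior algebra. -/
def eta : SuperClifford β ≃ₗ[ℂ] SuperExterior V :=
  have h : ∀ x y, β.toBilin x y = (SuperForm.zero V).toBilin x y + β.toBilin x y := fun x y => by
    simp [SuperForm.zero]
  have h' : ∀ x y, (SuperForm.zero V).toBilin x y = β.toBilin x y + β.neg.toBilin x y :=
    fun x y => by simp [SuperForm.zero, SuperForm.neg]
  have h'' : ∀ x y, β.toBilin x y = (SuperForm.zero V).toBilin x y + β.neg.neg.toBilin x y :=
    fun x y => by simp [SuperForm.zero, SuperForm.neg]
  have e : β.neg.neg = β := by cases β; simp [SuperForm.neg]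
  { changeForm (SuperForm.zero V) β β h with
    invFun := changeForm β (SuperForm.zero V) β.neg h'
    left_inv := changeForm_changeForm h h'
    right_inv := fun u => by
      have H := changeForm_changeForm h' h'' u
      simp only [e] at H
      exact H }

end SuperClifford

/-- The canonical map from `V` to its exterior algebra. -/
abbrev extι (V : Type*) [AddCommGroup V] [Module ℂ V] [SuperSpace V] : V →ₗ[ℂ] SuperExterior V :=
  SuperClifford.ι (SuperForm.zero V)

/-- The `n`-th exterior power `Λⁿ(V)`, the span of the products of `n` vectors in `Λ(V)`. -/
def extPower (V : Type*) [AddCommGroup V] [Module ℂ V] [SuperSpace V] (n : ℕ) :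
    Submodule ℂ (SuperExterior V) := LinearMap.range (extι V) ^ n

/-! ### Lie superalgebras and their enveloping algebras -/

/-- A complex Lie superalgebra. -/
class LieSuperalgebra (g : Type*) [AddCommGroup g] [Module ℂ g] extends SuperSpace g where
  /-- The bracket. -/
  bracket : g →ₗ[ℂ] g →ₗ[ℂ] g
  bracket_mem : ∀ i j, ∀ x ∈ part i, ∀ y ∈ part j, bracket x y ∈ part (i + j)
  bracket_skew : ∀ i j, ∀ x ∈ part i, ∀ y ∈ part j, bracket x y = -(ksign i j • bracket y x)
  jacobi : ∀ i j k, ∀ x ∈ part i, ∀ y ∈ part j, ∀ z ∈ part k, bracket x (bracket y z) =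
    bracket (bracket x y) z + ksign i j • bracket y (bracket x z)

/-- A subspace is a subalgebra of a Lie superalgebra if it is a super subspace closed under the
bracket. -/
class IsLieSubsuperalgebra {g : Type*} [AddCommGroup g] [Module ℂ g] [LieSuperalgebra g]
    (r : Submodule ℂ g) : Prop extends IsSuperSubspace r where
  bracket_mem : ∀ x ∈ r, ∀ y ∈ r, LieSuperalgebra.bracket x y ∈ r

/-- A subalgebra of a Lie superalgebra is a Lie superalgebra. -/
instance subLieSuperalgebra {g : Type*} [AddCommGroup g] [Module ℂ g] [LieSuperalgebra g]
    (r : Submodule ℂ g) [IsLieSubsuperalgebra r] : LieSuperalgebra r where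
  toSuperSpace := subSuperSpace r
  bracket := LinearMap.mk₂ ℂ
    (fun x y => ⟨LieSuperalgebra.bracket (x : g) (y : g),
      IsLieSubsuperalgebra.bracket_mem _ x.2 _ y.2⟩)
    (fun _ _ _ => Subtype.ext (by simp)) (fun _ _ _ => Subtype.ext (by simp))
    (fun _ _ _ => Subtype.ext (by simp)) (fun _ _ _ => Subtype.ext (by simp))
  bracket_mem i j x hx y hy := LieSuperalgebra.bracket_mem i j (x : g) hx (y : g) hy
  bracket_skew i j x hx y hy :=
    Subtype.ext (LieSuperalgebra.bracket_skew i j (x : g) hx (y : g) hy)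
  jacobi i j k x hx y hy z hz :=
    Subtype.ext (LieSuperalgebra.jacobi i j k (x : g) hx (y : g) hy (z : g) hz)

section Enveloping

variable (g : Type*) [AddCommGroup g] [Module ℂ g] [LieSuperalgebra g]

/-- The relations `x ⊗ y - (-1)^{|x||y|} y ⊗ x = [x, y]` for homogeneous `x`, `y`. -/
inductive EnvelopingRel : TensorAlgebra ℂ g → TensorAlgebra ℂ g → Prop
  | mk {i j : ZMod 2} {x y : g} (hx : x ∈ (part i : Submodule ℂ g))
      (hy : y ∈ (part j : Submodule ℂ g)) :
      EnvelopingRel (TensorAlgebra.ι ℂ x * TensorAlgebra.ι ℂ y -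
          ksign i j • (TensorAlgebra.ι ℂ y * TensorAlgebra.ι ℂ x))
        (TensorAlgebra.ι ℂ (LieSuperalgebra.bracket x y))

/-- The universal enveloping algebra of a Lie superalgebra. -/
def Enveloping : Type _ := RingQuot (EnvelopingRel g)

instance : Ring (Enveloping g) := inferInstanceAs (Ring (RingQuot (EnvelopingRel g)))

instance : Algebra ℂ (Enveloping g) :=
  inferInstanceAs (Algebra ℂ (RingQuot (EnvelopingRel g)))

namespace Enveloping

/-- The quotient map from the tensor algebra to the enveloping algebra. -/
def mk : TensorAlgebra ℂ g →ₐ[ℂ] Enveloping g := RingQuot.mkAlgHom ℂ (EnvelopingRel g)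

theorem mk_surjective : Function.Surjective (mk g) := RingQuot.mkAlgHom_surjective ℂ _

/-- The canonical map from a Lie superalgebra to its enveloping algebra. -/
def ι : g →ₗ[ℂ] Enveloping g := (mk g).toLinearMap ∘ₗ TensorAlgebra.ι ℂ

variable {g}

theorem ι_rel {i j : ZMod 2} {x y : g} (hx : x ∈ (part i : Submodule ℂ g))
    (hy : y ∈ (part j : Submodule ℂ g)) :
    ι g x * ι g y - ksign i j • (ι g y * ι g x) = ι g (LieSuperalgebra.bracket x y) := by
  have h : mk g _ = mk g _ := RingQuot.mkAlgHom_rel ℂ (EnvelopingRel.mk hx hy)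
  rw [map_sub, map_mul, map_smul, map_mul] at h
  exact h

variable {A : Type*} [Ring A] [Algebra ℂ A]

/-- The universal property of the enveloping algebra. -/
def lift (f : g →ₗ[ℂ] A)
    (hf : ∀ i j, ∀ x ∈ (part i : Submodule ℂ g), ∀ y ∈ (part j : Submodule ℂ g),
      f x * f y - ksign i j • (f y * f x) = f (LieSuperalgebra.bracket x y)) :
    Enveloping g →ₐ[ℂ] A :=
  RingQuot.liftAlgHom ℂ ⟨TensorAlgebra.lift ℂ f, by
    rintro _ _ ⟨hx, hy⟩
    simpa using hf _ _ _ hx _ hy⟩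

@[simp] theorem lift_ι (f : g →ₗ[ℂ] A) (hf) (x : g) : lift f hf (ι g x) = f x := by
  have h := RingQuot.liftAlgHom_mkAlgHom_apply ℂ (TensorAlgebra.lift ℂ f)
    (s := EnvelopingRel g) (by rintro _ _ ⟨hx, hy⟩; simpa using hf _ _ _ hx _ hy)
    (TensorAlgebra.ι ℂ x)
  rw [TensorAlgebra.lift_ι_apply] at h
  exact h

theorem adjoin_range_ι : Algebra.adjoin ℂ (Set.range (ι g)) = ⊤ := by
  rw [ι, LinearMap.coe_comp, Set.range_comp, AlgHom.coe_toLinearMap, ← AlgHom.map_adjoin,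
    TensorAlgebra.adjoin_range_ι, Algebra.map_top, AlgHom.range_eq_top]
  exact mk_surjective g

variable (g)

/-- The parity automorphism, `x ↦ (-1)^{|x|} x` for homogeneous `x ∈ g`. -/
def parityHom : Enveloping g →ₐ[ℂ] Enveloping g :=
  lift (ι g ∘ₗ signMap 1) (by
    intro i j x hx y hy
    simp only [LinearMap.comp_apply, signMap_apply hx, signMap_apply hy, map_smul,
      signMap_apply (LieSuperalgebra.bracket_mem i j x hx y hy)]
    rw [smul_mul_smul_comm, smul_mul_smul_comm, smul_comm, mul_comm (ksign 1 j), ← smul_sub,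
      ι_rel hx hy, ksign_add_right])

/-- The `ℤ/2`-grading of the enveloping algebra that is inherited from the tensor algebra. -/
def grading (i : ZMod 2) : Submodule ℂ (Enveloping g) := monomialPart (ι g) i

instance : GradedAlgebra (grading g) :=
  monomialGradedAlgebra (ι g) (parityHom g)
    (by intro i x hx; simp [parityHom, signMap_apply hx]) adjoin_range_ι

/-- The adjoint representation `ad x = [x, ·]`, extended to the enveloping algebra. -/
def ad : Enveloping g →ₐ[ℂ] Module.End ℂ g :=
  lift LieSuperalgebra.bracket (by
    intro i j x hx y hy
    apply linearMap_ext
    intro k z hz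
    simp only [LinearMap.sub_apply, LinearMap.smul_apply, Module.End.mul_apply]
    rw [LieSuperalgebra.jacobi i j k x hx y hy z hz, add_sub_cancel_right])

variable {g}

/-- The element `∑ᵢ bᵢ bⁱ` of the enveloping algebra attached to two finite families. It is the
Casimir element when `b` is a basis and `b'` is its dual basis for an invariant form. -/
def casimir {I : Type*} [Fintype I] (b b' : I → g) : Enveloping g := ∑ i, ι g (b i) * ι g (b' i)

end Enveloping

end Enveloping

/-! ### The cubic Dirac operator -/

section Dirac

variable {g : Type*} [AddCommGroup g] [Module ℂ g] [LieSuperalgebra g]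

/-- Invariance of a form: `([x, y], z) = (x, [y, z])`. -/
def SuperForm.IsInvariant (β : SuperForm g) : Prop :=
  ∀ x y z, β.toBilin (LieSuperalgebra.bracket x y) z = β.toBilin x (LieSuperalgebra.bracket y z)

variable (β : SuperForm g) (r : Submodule ℂ g) [IsLieSubsuperalgebra r]

/-- The Clifford algebra `C(p)` of the orthogonal complement `p` of `r`. -/
abbrev CliffordP : Type _ := SuperClifford (β.restrict (perp β r))

/-- The canonical map `p → C(p)`. -/
abbrev ιP : perp β r →ₗ[ℂ] CliffordP β r := SuperClifford.ι (β.restrict (perp β r))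

/-- The superalgebra `U(g) ⊗ C(p)`, with the product
`(u ⊗ v) (u' ⊗ v') = (-1)^{|v||u'|} u u' ⊗ v v'`. -/
abbrev DiracAlgebra : Type _ :=
  Enveloping.grading g ᵍ⊗[ℂ] SuperClifford.grading (β.restrict (perp β r))

/-- The embedding `u ↦ u ⊗ 1` of `U(g)`. -/
abbrev inclU : Enveloping g →ₐ[ℂ] DiracAlgebra β r :=
  GradedTensorProduct.includeLeft (Enveloping.grading g)
    (SuperClifford.grading (β.restrict (perp β r)))

/-- The embedding `v ↦ 1 ⊗ v` of `C(p)`. -/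
abbrev inclC : CliffordP β r →ₐ[ℂ] DiracAlgebra β r :=
  GradedTensorProduct.includeRight (Enveloping.grading g)
    (SuperClifford.grading (β.restrict (perp β r)))

/-- The action `[x, y] ∈ p` of `x ∈ r` on `y ∈ p`. -/
def actP {β : SuperForm g} (hinv : β.IsInvariant) {r : Submodule ℂ g} [IsLieSubsuperalgebra r]
    (x : r) (y : perp β r) : perp β r :=
  ⟨LieSuperalgebra.bracket (x : g) (y : g), mem_perp.2 fun z hz => by
    rw [← hinv]
    exact mem_perp.1 y.2 _ (IsLieSubsuperalgebra.bracket_mem z hz x x.2)⟩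

/-- The cubic element
`-1/12 ∑_{i,j,k} (-1)^{|yᵢ||yⱼ| + |yₖ||yₖ|} ([yᵢ, yⱼ], yₖ) yⁱ ∧ yʲ ∧ yᵏ` of `Λ³(p)` attached to a
homogeneous basis `yᵢ` of `p`, with parities `par i`, and its dual basis `yⁱ`. -/
def cubicElement {K : Type*} [Fintype K] (par : K → ZMod 2) (y y' : K → perp β r) :
    SuperExterior (perp β r) :=
  (-1 / 12 : ℂ) • ∑ i, ∑ j, ∑ k,
    (ksign (par i) (par j) * ksign (par k) (par k) *
        β.toBilin (LieSuperalgebra.bracket (y i : g) (y j : g)) (y k : g)) •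
      (extι (perp β r) (y' i) * extι (perp β r) (y' j) * extι (perp β r) (y' k))

/-- The cubic Dirac operator `∑ᵢ yᵢ ⊗ yⁱ + 1 ⊗ φ`, where `φ` is the element of `C(p)` that
corresponds to the cubic element of `Λ³(p)` under `η : C(p) ≃ Λ(p)`. -/
def cubicDirac {K : Type*} [Fintype K] (par : K → ZMod 2) (y y' : K → perp β r) :
    DiracAlgebra β r :=
  (∑ i, GradedTensorProduct.tmul ℂ (Enveloping.ι g (y i : g)) (ιP β r (y' i))) +
    GradedTensorProduct.tmul ℂ 1
      ((SuperClifford.eta (β.restrict (perp β r))).symm (cubicElement β r par y y'))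

variable {β r} in
/-- `ν : r → C(p)` is the homomorphism of Lie superalgebras from `r` to `Λ²(p)`, with the
Clifford super-commutator, that induces the adjoint action of `r` on `p`:
`ν(x) y - (-1)^{|x||y|} y ν(x) = [x, y]` for homogeneous `x ∈ r` and `y ∈ p`. -/
structure IsNuStar (hinv : β.IsInvariant) (ν : r →ₗ[ℂ] CliffordP β r) : Prop where
  mem_extPower : ∀ x, SuperClifford.eta (β.restrict (perp β r)) (ν x) ∈ extPower (perp β r) 2
  mem_grading : ∀ i, ∀ x ∈ (part i : Submodule ℂ r),
    ν x ∈ SuperClifford.grading (β.restrict (perp β r)) i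
  map_bracket : ∀ i j, ∀ x ∈ (part i : Submodule ℂ r), ∀ z ∈ (part j : Submodule ℂ r),
    ν (LieSuperalgebra.bracket x z) = ν x * ν z - ksign i j • (ν z * ν x)
  commutator : ∀ i j, ∀ x ∈ (part i : Submodule ℂ r), ∀ y ∈ (part j : Submodule ℂ (perp β r)),
    ν x * ιP β r y - ksign i j • (ιP β r y * ν x) = ιP β r (actP hinv x y)

theorem includeRight_mul_includeLeft {A B : Type*} [Ring A] [Ring B] [Algebra ℂ A] [Algebra ℂ B]
    (𝒜 : ZMod 2 → Submodule ℂ A) (ℬ : ZMod 2 → Submodule ℂ B) [GradedAlgebra 𝒜] [GradedAlgebra ℬ]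
    {i j : ZMod 2} {a : A} {b : B} (ha : a ∈ 𝒜 i) (hb : b ∈ ℬ j) :
    GradedTensorProduct.includeRight 𝒜 ℬ b * GradedTensorProduct.includeLeft 𝒜 ℬ a =
      ksign i j • (GradedTensorProduct.includeLeft 𝒜 ℬ a *
        GradedTensorProduct.includeRight 𝒜 ℬ b) := by
  have h1 := GradedTensorProduct.tmul_coe_mul_coe_tmul 𝒜 ℬ (R := ℂ) 1 ⟨b, hb⟩ ⟨a, ha⟩ 1
  have h2 := GradedTensorProduct.tmul_one_mul_one_tmul 𝒜 ℬ (R := ℂ) a b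
  rw [one_mul, mul_one] at h1
  refine h1.trans ?_
  rw [← h2]
  rcases zmod2_cases i with rfl | rfl <;> rcases zmod2_cases j with rfl | rfl <;>
    simp

variable {β r} in
/-- The diagonal embedding `x ↦ x ⊗ 1 + 1 ⊗ ν(x)` of `r`, extended to a homomorphism from `U(r)`
to `U(g) ⊗ C(p)`. -/
def zeta {hinv : β.IsInvariant} {ν : r →ₗ[ℂ] CliffordP β r} (hν : IsNuStar hinv ν) :
    Enveloping r →ₐ[ℂ] DiracAlgebra β r :=
  Enveloping.lift
    ((inclU β r).toLinearMap ∘ₗ Enveloping.ι g ∘ₗ r.subtype + (inclC β r).toLinearMap ∘ₗ ν) (by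
    intro i j x hx z hz
    have hx' : Enveloping.ι g (x : g) ∈ Enveloping.grading g i := mem_monomialPart _ hx
    have hz' : Enveloping.ι g (z : g) ∈ Enveloping.grading g j := mem_monomialPart _ hz
    have c1 := includeRight_mul_includeLeft (Enveloping.grading g)
      (SuperClifford.grading (β.restrict (perp β r))) hz' (hν.mem_grading i x hx)
    have c2 := includeRight_mul_includeLeft (Enveloping.grading g)
      (SuperClifford.grading (β.restrict (perp β r))) hx' (hν.mem_grading j z hz)
    have e1 := congrArg (inclU β r) (Enveloping.ι_rel (x := (x : g)) (y := (z : g)) hx hz)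
    have e2 := congrArg (inclC β r) (hν.map_bracket i j x hx z hz)
    simp only [map_sub, map_mul, map_smul] at e1 e2
    change _ = inclU β r (Enveloping.ι g (LieSuperalgebra.bracket (x : g) (z : g))) +
      inclC β r (ν (LieSuperalgebra.bracket x z))
    rw [← e1, e2]
    simp only [LinearMap.add_apply, LinearMap.comp_apply, AlgHom.toLinearMap_apply,
      Submodule.subtype_apply, add_mul, mul_add, c1, c2]
    have h3 := congrArg (fun c : ℂ => c • (inclU β r (Enveloping.ι g (x : g)) * inclC β r (ν z)))
      (ksign_mul_self i j)
    rw [ksign_comm j i]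
    linear_combination (norm := module) -h3)

end Dirac

end SuperDirac
end

noncomputable section

namespace SuperDirac

/-! ### Dual frames of a super-symmetric form -/

section Frames

variable {V : Type*} [AddCommGroup V] [Module ℂ V] [SuperSpace V] {β : SuperForm V}

/-! Everything rests on contractions in C(p). Under the identification with Λ(p), the contraction
ι(z) is half of the commutator with z, taken with signs from both the parity and the degree modulo 2
(`two_smul_contract`). An element killed by all contractions is a scalar, because it is killed by
the Euler operator ∑ bᵢ ∧ ι(b'ᵢ), which acts on Λⁿ as n (`eq_tau_of_contract_eq_zero`). Thus
elements of C(p) can be compared by contracting them and then comparing scalar parts.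

A super-skew operator T of p gives ν(T) = 1/4 ∑ T(yᵢ) ∧ yⁱ, whose commutator with z ∈ p is T z
(`nu_mul_ι`, `nu_commutator`). For T = [w, ·]_p with w ∈ g this element is called `spin w`. On r it
is the required map, and the scalar criterion gives uniqueness (`isNuStar_spin`, `IsNuStar.unique`).
On p it describes the cubic element φ, since ι(z)φ = `spin z` (`contract_cubic`).

Squaring ∑ yᵢ ⊗ yⁱ + 1 ⊗ φ gives ∑ yᵢ yⁱ from the symmetric part, and brackets [yᵢ, yⱼ] from the
skew part. The p-components of the brackets cancel against the anticommutator with φ, and the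
r-components give -2 ∑ xₐ ⊗ ν(xᵃ) (`sum_add_cubic_mul_self`). Comparison with ζ(Cas_r) leaves Cas_g
⊗ 1 - ζ(Cas_r) + 1 ⊗ s, where s = φ² + ∑ ν(xₐ)ν(xᵃ).

It remains to see that s is a scalar and to find it. Two contractions kill s
(`contract_contract_spinScalar`): the failure of w ↦ [w, ·]_p to be a representation comes from the
r-components dropped by the projection, and the Casimir term of s compensates it. One contraction of
s is therefore a scalar, but its degree is odd, so it is zero and s is a scalar (`spinScalar_eq`).
The scalar parts of the two summands of s are sums of pairings of brackets; splitting the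
supertraces along g = r ⊕ p gives the same sums (`tau_spinScalar`). -/

theorem SuperForm.apply_eq_zero (β : SuperForm V) {i j : ZMod 2} (h : i ≠ j) {x y : V}
    (hx : x ∈ (part i : Submodule ℂ V)) (hy : y ∈ (part j : Submodule ℂ V)) :
    β.toBilin x y = 0 := β.consistent i j h x hx y hy

/-- Only the component of y with the parity of x pairs with x, so the sign depends on x alone and y
need not be homogeneous. -/
theorem SuperForm.apply_comm_left (β : SuperForm V) {i : ZMod 2} {x : V}
    (hx : x ∈ (part i : Submodule ℂ V)) (y : V) :
    β.toBilin x y = ksign i i * β.toBilin y x := by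
  rw [← proj_add_proj y, map_add, map_add, LinearMap.add_apply]
  have h : ∀ j, β.toBilin x (proj j y) = ksign i i * β.toBilin (proj j y) x := by
    intro j
    rcases eq_or_ne i j with rfl | h
    · exact β.supersymm i i x hx _ (proj_mem i y)
    · rw [β.apply_eq_zero h hx (proj_mem j y), β.apply_eq_zero h.symm (proj_mem j y) hx, mul_zero]
  rw [h, h, mul_add]

theorem SuperForm.apply_comm_right (β : SuperForm V) {i : ZMod 2} {x : V}
    (hx : x ∈ (part i : Submodule ℂ V)) (y : V) :
    β.toBilin y x = ksign i i * β.toBilin x y := by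
  rw [β.apply_comm_left hx y, ← mul_assoc, ksign_mul_self, one_mul]

theorem SuperForm.flip_eq_zero (β : SuperForm V) {w : V} (h : ∀ z, β.toBilin w z = 0) (z : V) :
    β.toBilin z w = 0 := by
  rw [← proj_add_proj z, map_add, LinearMap.add_apply, β.apply_comm_left (proj_mem 0 z),
    β.apply_comm_left (proj_mem 1 z), h, h, mul_zero, mul_zero, add_zero]

/-- The families `b` and `b'` are dual frames: `z = ∑ᵢ (b'ᵢ, z) bᵢ` for all `z`. -/
structure SuperForm.IsFrame (β : SuperForm V) {ι : Type*} [Fintype ι] (b b' : ι → V) : Prop where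
  expand : ∀ z, ∑ i, β.toBilin (b' i) z • b i = z

namespace SuperForm.IsFrame

variable {ι : Type*} [Fintype ι] {b b' : ι → V}

/-- The existence of a frame already forces non-degeneracy: the coefficients of w are pairings with
w. -/
theorem eq_zero (h : β.IsFrame b b') {w : V} (hw : ∀ z, β.toBilin w z = 0) : w = 0 := by
  rw [← h.expand w]
  exact Finset.sum_eq_zero fun i _ => by rw [β.flip_eq_zero hw, zero_smul]

theorem expand' (h : β.IsFrame b b') (w : V) : ∑ i, β.toBilin w (b i) • b' i = w := by
  rw [← sub_eq_zero]
  refine h.eq_zero fun z => ?_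
  conv_lhs => rw [map_sub, LinearMap.sub_apply, ← h.expand z]
  rw [h.expand z, sub_eq_zero]
  conv_rhs => rw [← h.expand z]
  simp [map_sum, LinearMap.sum_apply, mul_comm]

theorem of_isDual [DecidableEq ι] {b : Module.Basis ι ℂ V} (h : β.IsDual b b') :
    β.IsFrame b b' where
  expand z := by
    have : ∀ i, β.toBilin (b' i) z = b.repr z i := by
      intro i
      conv_lhs => rw [← b.sum_repr z]
      rw [map_sum, Finset.sum_eq_single i]
      · rw [map_smul, h i i, if_pos rfl, smul_eq_mul, mul_one]
      · intro j _ hj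
        rw [map_smul, h i j, if_neg hj.symm, smul_zero]
      · exact fun hi => (hi (Finset.mem_univ i)).elim
    simp only [this]
    exact b.sum_repr z

theorem sum_apply (h : β.IsFrame b b') {M : Type*} [AddCommGroup M] [Module ℂ M]
    (F : V →ₗ[ℂ] M) (z : V) : ∑ i, β.toBilin (b' i) z • F (b i) = F z := by
  conv_rhs => rw [← h.expand z]
  simp

theorem sum_apply' (h : β.IsFrame b b') {M : Type*} [AddCommGroup M] [Module ℂ M]
    (F : V →ₗ[ℂ] M) (z : V) : ∑ i, β.toBilin z (b i) • F (b' i) = F z := by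
  conv_rhs => rw [← h.expand' z]
  simp

/-- The tensor `∑ᵢ bᵢ ⊗ b'ᵢ` does not depend on the dual frames. -/
theorem sum_eq_sum (h : β.IsFrame b b') {κ : Type*} [Fintype κ] {c c' : κ → V}
    (hc : β.IsFrame c c') {M : Type*} [AddCommGroup M] [Module ℂ M]
    (B : V →ₗ[ℂ] V →ₗ[ℂ] M) : ∑ i, B (b i) (b' i) = ∑ j, B (c j) (c' j) := by
  have h1 : ∀ i, B (b i) (b' i) = ∑ j, β.toBilin (c' j) (b i) • B (c j) (b' i) := fun i =>
    (hc.sum_apply (B.flip (b' i)) (b i)).symm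
  simp_rw [h1]
  rw [Finset.sum_comm]
  exact Finset.sum_congr rfl fun j _ => h.sum_apply' (B (c j)) (c' j)

theorem trace_eq (h : β.IsFrame b b') [FiniteDimensional ℂ V] (T : V →ₗ[ℂ] V) :
    LinearMap.trace ℂ V T = ∑ i, β.toBilin (b' i) (T (b i)) := by
  have : T = ∑ i, (β.toBilin (b' i)).smulRight (T (b i)) := by
    ext z
    simpa using (h.sum_apply T z).symm
  conv_lhs => rw [this]
  rw [map_sum]
  exact Finset.sum_congr rfl fun i _ => LinearMap.trace_smulRight _ _

end SuperForm.IsFrame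

/-- Dual frames that consist of homogeneous vectors with parities `par i`. -/
structure SuperForm.IsHomFrame (β : SuperForm V) {ι : Type*} [Fintype ι] (par : ι → ZMod 2)
    (b b' : ι → V) : Prop extends β.IsFrame b b' where
  mem : ∀ i, b i ∈ (part (par i) : Submodule ℂ V)
  mem' : ∀ i, b' i ∈ (part (par i) : Submodule ℂ V)

namespace SuperForm.IsHomFrame

variable {ι : Type*} [Fintype ι] {b b' : ι → V} {par : ι → ZMod 2}
  {M : Type*} [AddCommGroup M] [Module ℂ M]

theorem of_isDual [DecidableEq ι] {b : Module.Basis ι ℂ V} (h : β.IsDual b b')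
    (hb : ∀ i, b i ∈ (part (par i) : Submodule ℂ V)) : β.IsHomFrame par b b' where
  toIsFrame := .of_isDual h
  mem := hb
  mem' i := by
    have hf : β.IsFrame b b' := .of_isDual h
    -- The component of `b' i` of the wrong parity pairs to zero with every basis vector: with those
    -- of its own parity by duality, with the others by consistency.
    have hz : proj (par i + 1) (b' i) = 0 := by
      refine hf.eq_zero fun z => ?_
      rw [← β.apply_proj]
      have : β.toBilin (b' i) ∘ₗ proj (par i + 1) = 0 := by
        refine b.ext fun j => ?_
        rw [LinearMap.comp_apply, LinearMap.zero_apply]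
        rcases eq_or_ne (par j) (par i + 1) with e | e
        · rw [proj_same (e ▸ hb j), h i j, if_neg]
          rintro rfl
          simp at e
        · rw [proj_ne e (hb j), map_zero]
      exact LinearMap.congr_fun this z
    have h1 := proj_add_proj (b' i)
    have h2 := proj_mem (par i) (b' i)
    rcases zmod2_cases (par i) with e | e <;> rw [e] at hz h2 ⊢
    · rw [zero_add] at hz
      rw [hz, add_zero] at h1
      rwa [h1] at h2
    · rw [show (1 + 1 : ZMod 2) = 0 from rfl] at hz
      rw [hz, zero_add] at h1
      rwa [h1] at h2

/-- Koszul signs that depend on the summation index may stay in the sum, because only indices with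
the parity of z contribute. -/
theorem sum_apply_par (h : β.IsHomFrame par b b') {j : ZMod 2} {z : V}
    (hz : z ∈ (part j : Submodule ℂ V)) (G : ZMod 2 → V →ₗ[ℂ] M) :
    ∑ i, β.toBilin (b' i) z • G (par i) (b i) = G j z := by
  rw [← h.sum_apply (G j) z]
  refine Finset.sum_congr rfl fun i _ => ?_
  rcases eq_or_ne (par i) j with e | e
  · rw [e]
  · rw [β.apply_eq_zero e (h.mem' i) hz, zero_smul, zero_smul]

theorem sum_apply_par' (h : β.IsHomFrame par b b') {j : ZMod 2} {z : V}
    (hz : z ∈ (part j : Submodule ℂ V)) (G : ZMod 2 → V →ₗ[ℂ] M) :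
    ∑ i, β.toBilin z (b i) • G (par i) (b' i) = G j z := by
  rw [← h.sum_apply' (G j) z]
  refine Finset.sum_congr rfl fun i _ => ?_
  rcases eq_or_ne (par i) j with e | e
  · rw [e]
  · rw [β.apply_eq_zero e.symm hz (h.mem i), zero_smul, zero_smul]

/-- Expanding b'ᵢ in the frame b produces the coefficients (b'ⱼ, b'ᵢ). Reversing this pairing costs
the stated sign, after which the sum over i collapses. -/
theorem sum_swap (h : β.IsHomFrame par b b') (B : ZMod 2 → V →ₗ[ℂ] V →ₗ[ℂ] M) :
    ∑ i, B (par i) (b i) (b' i) = ∑ i, ksign (par i) (par i) • B (par i) (b' i) (b i) := by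
  have h1 : ∀ i, ksign (par i) (par i) • B (par i) (b' i) (b i) =
      ∑ j, β.toBilin (b' i) (b' j) • B (par j) (b j) (b i) := fun i => by
    have h2 := h.sum_apply_par (h.mem' i) (fun k => (B k).flip (b i))
    rw [LinearMap.flip_apply] at h2
    rw [← h2, Finset.smul_sum]
    refine Finset.sum_congr rfl fun j _ => ?_
    rw [β.apply_comm_left (h.mem' i), mul_smul]
    rfl
  simp_rw [h1]
  rw [Finset.sum_comm]
  exact Finset.sum_congr rfl fun j _ => (h.sum_apply (B (par j) (b j)) (b' j)).symm

/-- Exchanging the arguments of (b'ᵢ, T bᵢ) yields exactly the minus sign that the supertrace puts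
on the odd block. -/
theorem supertrace_eq (h : β.IsHomFrame par b b') [FiniteDimensional ℂ V] (T : V →ₗ[ℂ] V) :
    supertrace T = ∑ i, β.toBilin (T (b i)) (b' i) := by
  rw [supertrace, h.trace_eq, h.trace_eq, ← Finset.sum_sub_distrib]
  refine Finset.sum_congr rfl fun i _ => ?_
  simp only [LinearMap.comp_apply, β.apply_proj]
  rw [β.apply_comm_right (h.mem' i)]
  have h1 := h.mem' i
  have h2 := h.mem i
  rcases zmod2_cases (par i) with e | e <;> rw [e] at h1 h2 ⊢
  · simp [proj_same h1, proj_same h2, proj_ne (by decide : (0 : ZMod 2) ≠ 1) h1]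
  · simp [proj_same h1, proj_same h2, proj_ne (by decide : (1 : ZMod 2) ≠ 0) h1]

end SuperForm.IsHomFrame

/-- A non-degenerate form has homogeneous dual frames. -/
theorem SuperForm.exists_isHomFrame [FiniteDimensional ℂ V] (β : SuperForm V)
    (hβ : β.toBilin.Nondegenerate) :
    ∃ (n : ℕ) (par : Fin n → ZMod 2) (b b' : Fin n → V), β.IsHomFrame par b b' := by
  let b₀ := (Module.finBasis ℂ (part 0 : Submodule ℂ V)).prod
    (Module.finBasis ℂ (part 1 : Submodule ℂ V))
  let b₁ := b₀.map (Submodule.prodEquivOfIsCompl _ _ (SuperSpace.isCompl (V := V)))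
  let b := b₁.reindex finSumFinEquiv
  refine ⟨_, fun i => Sum.elim (fun _ => 0) (fun _ => 1) (finSumFinEquiv.symm i), b,
    β.toBilin.dualBasis hβ b, .of_isDual (fun i j => ?_) fun i => ?_⟩
  · rw [LinearMap.BilinForm.apply_dualBasis_left]
    simp only [eq_comm]
  · rw [show b i = b₁ (finSumFinEquiv.symm i) from Module.Basis.reindex_apply _ _ _]
    rcases finSumFinEquiv.symm i with k | k
    · simp [b₁, b₀]
    · simp [b₁, b₀]

/-! ### Frames of super subspaces -/

variable (β) in
/-- The orthogonal projection onto a super subspace with dual frames `b`, `b'`. -/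
def frameProj {W : Submodule ℂ V} {ι : Type*} [Fintype ι] (b b' : ι → W) : V →ₗ[ℂ] W :=
  ∑ i, (β.toBilin (b' i)).smulRight (b i)

section frameProj

variable {W : Submodule ℂ V} {ι : Type*} [Fintype ι] {b b' : ι → W} {par : ι → ZMod 2}

theorem frameProj_apply (u : V) :
    frameProj β b b' u = ∑ i, β.toBilin (b' i) u • b i := by
  simp [frameProj]

theorem apply_perp_right {w : V} (hw : w ∈ W) (z : perp β W) : β.toBilin w z = 0 :=
  mem_perp.1 z.2 w hw

variable [IsSuperSubspace W]

theorem frameProj_coe (h : (β.restrict W).IsFrame b b') (w : W) : frameProj β b b' w = w := by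
  rw [frameProj_apply]
  exact h.expand w

theorem apply_frameProj (h : (β.restrict W).IsFrame b b') (w : W) (u : V) :
    β.toBilin w (frameProj β b b' u) = β.toBilin w u := by
  have h1 := congrArg (fun v : W => β.toBilin v u) (h.expand' w)
  simp only [Submodule.coe_sum, Submodule.coe_smul, map_sum, LinearMap.sum_apply, map_smul,
    LinearMap.smul_apply, smul_eq_mul, frameProj_apply] at h1 ⊢
  rw [← h1]
  exact Finset.sum_congr rfl fun i _ => mul_comm _ _

theorem frameProj_apply_left (h : (β.restrict W).IsFrame b b') (w : W) (u : V) :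
    β.toBilin (frameProj β b b' u) w = β.toBilin u w := by
  rw [← proj_add_proj w, Submodule.coe_add, map_add, map_add]
  have h1 : ∀ i, β.toBilin (frameProj β b b' u) (proj i w : W) = β.toBilin u (proj i w : W) := by
    intro i
    have hi : ((proj i w : W) : V) ∈ (part i : Submodule ℂ V) := proj_mem i w
    rw [β.apply_comm_right hi, β.apply_comm_right hi, apply_frameProj h]
  rw [h1, h1]

theorem frameProj_mem (h : (β.restrict W).IsHomFrame par b b') {i : ZMod 2} {u : V}
    (hu : u ∈ (part i : Submodule ℂ V)) : frameProj β b b' u ∈ (part i : Submodule ℂ W) := by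
  rw [frameProj_apply]
  refine Submodule.sum_mem _ fun j _ => ?_
  rcases eq_or_ne (par j) i with e | e
  · exact Submodule.smul_mem _ _ (e ▸ h.mem j)
  · have h0 : β.toBilin (b' j : V) u = 0 := β.apply_eq_zero e (h.mem' j) hu
    rw [h0, zero_smul]
    exact Submodule.zero_mem _

theorem sub_frameProj_mem_perp (h : (β.restrict W).IsFrame b b') (u : V) :
    u - frameProj β b b' u ∈ perp β W := by
  rw [mem_perp]
  intro w hw
  rw [map_sub, apply_frameProj h ⟨w, hw⟩, sub_self]

variable {κ : Type*} [Fintype κ] {c c' : κ → perp β W}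

theorem apply_perp_left (w : W) (z : perp β W) : β.toBilin z w = 0 := by
  rw [← proj_add_proj w, Submodule.coe_add, map_add]
  have h1 : ∀ i, β.toBilin z (proj i w : W) = 0 := by
    intro i
    have hi : ((proj i w : W) : V) ∈ (part i : Submodule ℂ V) := proj_mem i w
    rw [β.apply_comm_right hi, apply_perp_right (Subtype.mem _), mul_zero]
  rw [h1, h1, add_zero]

theorem frameProj_add_frameProj (h : (β.restrict W).IsFrame b b')
    (hc : (β.restrict (perp β W)).IsFrame c c') (u : V) :
    (frameProj β b b' u : V) + frameProj β c c' u = u := by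
  have h1 := frameProj_coe hc ⟨_, sub_frameProj_mem_perp h u⟩
  have h2 : frameProj β c c' (frameProj β b b' u : V) = 0 := by
    rw [frameProj_apply]
    exact Finset.sum_eq_zero fun i _ => by rw [apply_perp_left, zero_smul]
  simp only [map_sub, h2, sub_zero] at h1
  rw [h1]
  simp

theorem isHomFrame_sumElim {par' : κ → ZMod 2} (h : (β.restrict W).IsHomFrame par b b')
    (hc : (β.restrict (perp β W)).IsHomFrame par' c c') :
    β.IsHomFrame (Sum.elim par par') (Sum.elim (fun i => (b i : V)) fun k => (c k : V))
      (Sum.elim (fun i => (b' i : V)) fun k => (c' k : V)) where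
  expand z := by
    have := frameProj_add_frameProj h.toIsFrame hc.toIsFrame z
    simpa [frameProj_apply, Submodule.coe_sum] using this
  mem := by rintro (i | k); exacts [h.mem i, hc.mem k]
  mem' := by rintro (i | k); exacts [h.mem' i, hc.mem' k]

end frameProj

end Frames

/-! ### Contractions in the Clifford algebra -/

namespace SuperClifford

variable {V : Type*} [AddCommGroup V] [Module ℂ V] [SuperSpace V] {β : SuperForm V}

/-- Induction on words in the generators, obtained by comparing the quotient map modulo S with zero.
-/
theorem mem_of_stable (S : Submodule ℂ (SuperClifford β)) (h1 : (1 : SuperClifford β) ∈ S)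
    (h : ∀ x, ∀ u ∈ S, ι β x * u ∈ S) (u : SuperClifford β) : u ∈ S := by
  have H : S.mkQ = 0 := by
    apply linearMap_ext'
    · simpa using h1
    · intro i x _ u hu
      simp only [LinearMap.zero_apply, Submodule.mkQ_apply, Submodule.Quotient.mk_eq_zero] at hu ⊢
      exact h x u hu
  simpa using LinearMap.congr_fun H u

theorem twist_ι (k : ZMod 2) {i : ZMod 2} {x : V} (hx : x ∈ (part i : Submodule ℂ V)) :
    twist β k (ι β x) = -(ksign k i • ι β x) := by
  simp [twist, signMap_apply hx]

theorem twist_zero_ι (x : V) : twist β 0 (ι β x) = -ι β x := by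
  rw [← proj_add_proj x, map_add, map_add, twist_ι 0 (proj_mem 0 x), twist_ι 0 (proj_mem 1 x)]
  simp [add_comm]

theorem twist_of_mem (k : ZMod 2) {i : ZMod 2} {u : SuperClifford β} (hu : u ∈ grading β i) :
    twist β k u = ksign k i • twist β 0 u := by
  induction hu using Submodule.span_induction with
  | mem u hu =>
    induction hu with
    | one => simp
    | cons hx _ ih =>
      rw [map_mul, map_mul, twist_ι k hx, ih, twist_zero_ι, ksign_add_right, neg_mul, neg_mul,
        smul_mul_smul_comm, smul_neg]
  | zero => simp
  | add _ _ _ _ h1 h2 => rw [map_add, h1, h2, map_add, smul_add]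
  | smul c _ _ h => rw [map_smul, h, map_smul, smul_comm]

theorem ι_mem {i : ZMod 2} {x : V} (hx : x ∈ (part i : Submodule ℂ V)) :
    ι β x ∈ grading β i := mem_monomialPart _ hx

theorem one_mem_grading : (1 : SuperClifford β) ∈ grading β 0 := SetLike.GradedOne.one_mem

theorem mul_mem_grading {i j : ZMod 2} {u v : SuperClifford β} (hu : u ∈ grading β i)
    (hv : v ∈ grading β j) : u * v ∈ grading β (i + j) := SetLike.GradedMul.mul_mem hu hv

/-- Elements of parity `i` on which the involution `x ↦ -x` acts by `e`. -/
structure IsBihom (i : ZMod 2) (e : ℂ) (u : SuperClifford β) : Prop where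
  mem : u ∈ grading β i
  deg : twist β 0 u = e • u

theorem IsBihom.twist {i : ZMod 2} {e : ℂ} {u : SuperClifford β} (h : IsBihom i e u)
    (k : ZMod 2) : SuperClifford.twist β k u = (ksign k i * e) • u := by
  rw [twist_of_mem k h.mem, h.deg, smul_smul]

theorem contractHom_zero_zero (k : ZMod 2) (f : V →ₗ[ℂ] ℂ) (u : SuperClifford β) :
    contractHom β k f u 0 0 = twist β k u := by
  have h : LinearMap.proj 0 ∘ₗ LinearMap.proj 0 ∘ₗ
    (Matrix.ofLinearEquiv ℂ).symm.toLinearMap ∘ₗ (contractHom β k f).toLinearMap =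
      (twist β k).toLinearMap := by
    apply linearMap_ext'
    · change contractHom β k f 1 0 0 = twist β k 1
      rw [map_one, map_one, Matrix.one_apply_eq]
    · intro i x _ u hu
      change contractHom β k f u 0 0 = twist β k u at hu
      change contractHom β k f (SuperClifford.ι β x * u) 0 0 =
        twist β k (SuperClifford.ι β x * u)
      have h10 : contractHom β k f u 1 0 = 0 := by
        have h : LinearMap.proj 0 ∘ₗ LinearMap.proj 1 ∘ₗ
          (Matrix.ofLinearEquiv ℂ).symm.toLinearMap ∘ₗ (contractHom β k f).toLinearMap =
            (0 : SuperClifford β →ₗ[ℂ] SuperClifford β) := by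
          apply linearMap_ext'
          · change contractHom β k f 1 1 0 = 0
            rw [map_one, Matrix.one_apply_ne (by decide)]
          · intro i x _ u hu
            change contractHom β k f u 1 0 = 0 at hu
            change contractHom β k f (SuperClifford.ι β x * u) 1 0 = 0
            rw [map_mul, contractHom_ι, Matrix.mul_apply, Fin.sum_univ_two, hu]
            simp
        exact LinearMap.congr_fun h u
      rw [map_mul, map_mul, contractHom_ι, Matrix.mul_apply, Fin.sum_univ_two, hu, h10]
      simp
  exact LinearMap.congr_fun h u

/-- The twisted Leibniz rule is the upper right entry of a product of two upper triangular matrices.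
-/
theorem contract_mul (α : SuperForm V) {k : ZMod 2} {x : V} (hx : x ∈ (part k : Submodule ℂ V))
    (u v : SuperClifford β) :
    contract β α x (u * v) = contract β α x u * v + twist β k u * contract β α x v := by
  simp only [contract_eq β α hx, contractPart_apply]
  rw [map_mul, Matrix.mul_apply, Fin.sum_univ_two, contractHom_one_one, contractHom_zero_zero,
    add_comm]

theorem contract_ι (α : SuperForm V) (x y : V) :
    contract β α x (SuperClifford.ι β y) = α.toBilin x y • (1 : SuperClifford β) := by
  have h : ∀ i j, contract β α (proj i x) (SuperClifford.ι β (proj j y)) =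
      α.toBilin (proj i x) (proj j y) • (1 : SuperClifford β) := by
    intro i j
    have := contract_ι_mul β α (proj_mem i x) (proj_mem j y) 1
    simpa [contract_one] using this
  conv_lhs => rw [← proj_add_proj x, ← proj_add_proj y]
  conv_rhs => rw [← proj_add_proj x, ← proj_add_proj y]
  simp only [map_add, LinearMap.add_apply, h, add_smul]

/-- Both sides vanish at 1 and obey the same recursion under left multiplication by a generator; for
the right side this is the Clifford relation. It converts commutators with vectors into contractions
and back. -/
theorem two_smul_contract {k : ZMod 2} {x : V} (hx : x ∈ (part k : Submodule ℂ V))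
    (u : SuperClifford β) :
    (2 : ℂ) • contract β β x u =
      SuperClifford.ι β x * u - twist β k u * SuperClifford.ι β x := by
  have h : (2 : ℂ) • contract β β x = LinearMap.mulLeft ℂ (SuperClifford.ι β x) -
      LinearMap.mulRight ℂ (SuperClifford.ι β x) ∘ₗ (twist β k).toLinearMap := by
    apply linearMap_ext'
    · simp [contract_one]
    · intro j y hy u hu
      simp only [LinearMap.smul_apply, LinearMap.sub_apply, LinearMap.comp_apply,
        AlgHom.toLinearMap_apply, LinearMap.mulLeft_apply, LinearMap.mulRight_apply] at hu ⊢
      have h1 := congrArg (· * u) (ι_rel β hx hy)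
      simp only [add_mul, smul_mul_assoc, mul_assoc, ← Algebra.smul_def] at h1
      have h2 := congrArg (fun w => ksign k j • (SuperClifford.ι β y * w)) hu
      simp only [mul_sub, mul_smul_comm, smul_sub] at h2
      rw [contract_ι_mul β β hx hy, map_mul, twist_ι k hy, neg_mul, neg_mul, smul_mul_assoc,
        smul_mul_assoc, mul_assoc]
      linear_combination (norm := module) -h1 - h2
  exact LinearMap.congr_fun h u

theorem IsBihom.two_smul_contract {i k : ZMod 2} {e : ℂ} {u : SuperClifford β} {x : V}
    (hu : IsBihom i e u) (hx : x ∈ (part k : Submodule ℂ V)) :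
    (2 : ℂ) • contract β β x u =
      SuperClifford.ι β x * u - (ksign k i * e) • (u * SuperClifford.ι β x) := by
  rw [SuperClifford.two_smul_contract hx, hu.twist, smul_mul_assoc]

theorem IsBihom.contract_mul (α : SuperForm V) {i k : ZMod 2} {e : ℂ} {u : SuperClifford β} {x : V}
    (hu : IsBihom i e u) (hx : x ∈ (part k : Submodule ℂ V)) (v : SuperClifford β) :
    contract β α x (u * v) =
      contract β α x u * v + (ksign k i * e) • (u * contract β α x v) := by
  rw [SuperClifford.contract_mul α hx, hu.twist, smul_mul_assoc]

theorem eta_one : eta β 1 = 1 := changeForm_one _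

theorem eta_ι_mul (x : V) (u : SuperClifford β) :
    eta β (SuperClifford.ι β x * u) =
      extι V x * eta β u + contract (SuperForm.zero V) β x (eta β u) := changeForm_ι_mul _ x u

theorem eta_contract (x : V) (u : SuperClifford β) :
    eta β (contract β β x u) = contract (SuperForm.zero V) β x (eta β u) := by
  have h : ∀ i, eta β (contract β β (proj i x) u) =
      contract (SuperForm.zero V) β (proj i x) (eta β u) :=
    fun i => changeForm_contract _ (proj_mem i x) u
  rw [← proj_add_proj x]
  simp only [map_add, LinearMap.add_apply, h]

/-! ### The Euler operator -/

theorem extι_mul_comm {i j : ZMod 2} {x y : V} (hx : x ∈ (part i : Submodule ℂ V))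
    (hy : y ∈ (part j : Submodule ℂ V)) :
    extι V x * extι V y = -(ksign i j • (extι V y * extι V x)) := by
  have := ι_rel (SuperForm.zero V) hx hy
  rw [show (SuperForm.zero V).toBilin x y = 0 from rfl, mul_zero, map_zero] at this
  exact eq_neg_of_add_eq_zero_left this

section euler

variable {I : Type*} [Fintype I] {par : I → ZMod 2} {b b' : I → V}

variable (β) in
/-- The operator `∑ᵢ bᵢ ∧ ι(b'ᵢ)` on the exterior algebra, which multiplies `Λⁿ` by `n`. -/
def euler (b b' : I → V) : SuperExterior V →ₗ[ℂ] SuperExterior V :=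
  ∑ i, LinearMap.mulLeft ℂ (extι V (b i)) ∘ₗ contract (SuperForm.zero V) β (b' i)

theorem euler_apply (u : SuperExterior V) :
    euler β b b' u = ∑ i, extι V (b i) * contract (SuperForm.zero V) β (b' i) u := by
  simp [euler]

/-- Contracting y itself reassembles y from its frame coefficients. In the other term y moves past
ι(b'ᵢ) and bᵢ, and the two signs cancel. -/
theorem euler_ι_mul (h : β.IsHomFrame par b b') (y : V) (u : SuperExterior V) :
    euler β b b' (extι V y * u) = extι V y * u + extι V y * euler β b b' u := by
  have key : ∀ j, ∀ y ∈ (part j : Submodule ℂ V), euler β b b' (extι V y * u) =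
      extι V y * u + extι V y * euler β b b' u := by
    intro j y hy
    rw [euler_apply, euler_apply, Finset.mul_sum]
    have h1 : ∀ i, extι V (b i) * contract (SuperForm.zero V) β (b' i) (extι V y * u) =
        β.toBilin (b' i) y • (extι V (b i) * u) +
          extι V y * (extι V (b i) * contract (SuperForm.zero V) β (b' i) u) := by
      intro i
      rw [contract_ι_mul _ β (h.mem' i) hy, mul_sub, mul_smul_comm, mul_smul_comm, ← mul_assoc,
        ← mul_assoc, extι_mul_comm (h.mem i) hy, neg_mul, smul_neg, smul_mul_assoc, smul_smul,
        ksign_mul_self, one_smul, sub_neg_eq_add]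
    simp_rw [h1]
    rw [Finset.sum_add_distrib]
    congr 1
    exact h.sum_apply (LinearMap.mulRight ℂ u ∘ₗ extι V) y
  rw [← proj_add_proj y]
  simp only [map_add, add_mul, key 0 _ (proj_mem 0 y), key 1 _ (proj_mem 1 y)]
  abel

variable (V) in
/-- The span of the products of at most `n` vectors in the exterior algebra. -/
def extFiltration : ℕ → Submodule ℂ (SuperExterior V)
  | 0 => 1
  | n + 1 => extFiltration n ⊔ LinearMap.range (extι V) * extFiltration n

theorem extFiltration_mono : Monotone (extFiltration V) :=
  monotone_nat_of_le_succ fun _ => le_sup_left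

/-- A filtration is enough here, so Λ need not be decomposed into the Λⁿ: modulo products of at most
n vectors, the Euler operator is n + 1. Each further factor raises the eigenvalue by one. -/
theorem euler_sub_mem (h : β.IsHomFrame par b b') (n : ℕ) :
    ∀ u ∈ extFiltration V (n + 1),
      euler β b b' u - ((n + 1 : ℕ) : ℂ) • u ∈ extFiltration V n := by
  have step : ∀ m : ℂ, ∀ S T : Submodule ℂ (SuperExterior V),
      (∀ u ∈ S, euler β b b' u - m • u ∈ T) →
      ∀ u ∈ LinearMap.range (extι V) * S,
        euler β b b' u - (m + 1) • u ∈ LinearMap.range (extι V) * T := by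
    intro m S T hS u hu
    induction hu using Submodule.mul_induction_on' with
    | mem_mul_mem y hy v hv =>
      obtain ⟨y, rfl⟩ := hy
      have : euler β b b' (extι V y * v) - (m + 1) • (extι V y * v) =
          extι V y * (euler β b b' v - m • v) := by
        rw [euler_ι_mul h, mul_sub, mul_smul_comm]
        module
      rw [this]
      exact Submodule.mul_mem_mul ⟨y, rfl⟩ (hS v hv)
    | add u _ v _ h1 h2 =>
      rw [map_add, smul_add, add_sub_add_comm]
      exact add_mem h1 h2
  have zero : ∀ u ∈ extFiltration V 0, euler β b b' u = 0 := by
    intro u hu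
    obtain ⟨c, rfl⟩ := Submodule.mem_one.1 hu
    rw [Algebra.algebraMap_eq_smul_one, map_smul, euler_apply]
    simp [contract_one]
  induction n with
  | zero =>
    intro u hu
    obtain ⟨a, ha, c, hc, rfl⟩ := Submodule.mem_sup.1 hu
    -- Scalars are killed exactly, so the target can be ⊥ and products of one vector have eigenvalue
    -- exactly 1.
    have h0 := step 0 (extFiltration V 0) ⊥ (fun u hu => by simp [zero u hu]) c hc
    rw [Submodule.mul_bot, Submodule.mem_bot] at h0
    have : euler β b b' (a + c) - ((0 + 1 : ℕ) : ℂ) • (a + c) = -a := by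
      rw [map_add, zero a ha]
      push_cast
      linear_combination (norm := module) h0
    rw [this]
    exact neg_mem ha
  | succ n ih =>
    intro u hu
    obtain ⟨a, ha, c, hc, rfl⟩ := Submodule.mem_sup.1 hu
    have h1 := extFiltration_mono n.le_succ (ih a ha)
    have h2 : _ ∈ extFiltration V (n + 1) := Submodule.mem_sup_right (step _ _ _ ih c hc)
    have : euler β b b' (a + c) - ((n + 1 + 1 : ℕ) : ℂ) • (a + c) =
        euler β b b' a - ((n + 1 : ℕ) : ℂ) • a - a +
          (euler β b b' c - (((n + 1 : ℕ) : ℂ) + 1) • c) := by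
      rw [map_add]
      push_cast
      module
    rw [this]
    exact add_mem (sub_mem h1 ha) h2

theorem mem_one_of_euler_eq_zero (h : β.IsHomFrame par b b') {u : SuperExterior V}
    (hu : euler β b b' u = 0) : u ∈ (1 : Submodule ℂ (SuperExterior V)) := by
  have hall : ∃ n, u ∈ extFiltration V n := by
    have hdir := Monotone.directed_le (extFiltration_mono (V := V))
    refine (Submodule.mem_iSup_of_directed _ hdir).1
      (mem_of_stable _ (Submodule.mem_iSup_of_mem 0 (Submodule.one_le.1 le_rfl)) ?_ u)
    intro x v hv
    obtain ⟨n, hn⟩ := (Submodule.mem_iSup_of_directed _ hdir).1 hv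
    exact Submodule.mem_iSup_of_mem (n + 1)
      (Submodule.mem_sup_right (Submodule.mul_mem_mul ⟨x, rfl⟩ hn))
  obtain ⟨n, hn⟩ := hall
  induction n with
  | zero => exact hn
  | succ n ih =>
    have h1 := euler_sub_mem h n u hn
    rw [hu, zero_sub] at h1
    -- Since the Euler operator kills u, the multiple (n + 1) u lies one step lower in the
    -- filtration, and n + 1 is invertible.
    refine ih ((Submodule.smul_mem_iff _ ?_).1 (neg_mem_iff.1 h1))
    exact Nat.cast_ne_zero.2 n.succ_ne_zero

end euler

/-! ### The scalar part -/

variable (V) in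
/-- The augmentation of the exterior algebra. -/
def aug : SuperExterior V →ₐ[ℂ] ℂ :=
  lift (SuperForm.zero V) 0 (by simp [SuperForm.zero])

variable (β) in
/-- The scalar part of an element of the Clifford algebra. -/
def tau : SuperClifford β →ₗ[ℂ] ℂ := (aug V).toLinearMap ∘ₗ (eta β).toLinearMap

theorem tau_apply (u : SuperClifford β) : tau β u = aug V (eta β u) := rfl

theorem tau_one : tau β 1 = 1 := by rw [tau_apply, eta_one, map_one]

/-- Left multiplication by x is exterior multiplication plus contraction, and the augmentation kills
the exterior part. -/
theorem tau_ι_mul (x : V) (u : SuperClifford β) :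
    tau β (SuperClifford.ι β x * u) = tau β (contract β β x u) := by
  rw [tau_apply, tau_apply, eta_ι_mul, eta_contract, map_add, map_mul, aug, lift_ι]
  simp

/-- The Euler operator is built from contractions, so it kills such an element, and its kernel
consists of scalars. -/
theorem eq_tau_of_contract_eq_zero {I : Type*} [Fintype I] {par : I → ZMod 2} {b b' : I → V}
    (h : β.IsHomFrame par b b') {u : SuperClifford β}
    (hu : ∀ k, ∀ x ∈ (part k : Submodule ℂ V), contract β β x u = 0) :
    u = tau β u • (1 : SuperClifford β) := by
  have h1 : euler β b b' (eta β u) = 0 := by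
    rw [euler_apply]
    exact Finset.sum_eq_zero fun i _ => by
      rw [← eta_contract, hu _ _ (h.mem' i), map_zero, mul_zero]
  obtain ⟨c, hc⟩ := Submodule.mem_one.1 (mem_one_of_euler_eq_zero h h1)
  rw [Algebra.algebraMap_eq_smul_one, ← eta_one (β := β), ← map_smul] at hc
  rw [← (eta β).injective hc, map_smul, tau_one, smul_eq_mul, mul_one]

/-! ### Exterior multiplication on the Clifford algebra -/

variable (β) in
/-- The exterior multiplication by a vector, transported to the Clifford algebra. -/
def wedge : V →ₗ[ℂ] SuperClifford β →ₗ[ℂ] SuperClifford β :=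
  LinearMap.mul ℂ (SuperClifford β) ∘ₗ SuperClifford.ι β - contract β β

theorem wedge_apply (x : V) (u : SuperClifford β) :
    wedge β x u = SuperClifford.ι β x * u - contract β β x u := rfl

theorem eta_wedge (x : V) (u : SuperClifford β) :
    eta β (wedge β x u) = extι V x * eta β u := by
  rw [wedge_apply, map_sub, eta_ι_mul, eta_contract, add_sub_cancel_right]

theorem contract_wedge {i j : ZMod 2} {x z : V} (hz : z ∈ (part j : Submodule ℂ V))
    (hx : x ∈ (part i : Submodule ℂ V)) (u : SuperClifford β) :
    contract β β z (wedge β x u) =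
      β.toBilin z x • u - ksign j i • wedge β x (contract β β z u) := by
  rw [wedge_apply, wedge_apply, map_sub, contract_ι_mul β β hz hx]
  linear_combination (norm := module) -contract_anticomm β β hz hx u

/-- Under the scalar part, multiplication by x becomes a contraction of u v. Its Leibniz term on u
is removed by the correction in `wedge`. Exterior factors on the left thus turn into contractions of
the right factor. -/
theorem tau_wedge_mul {i : ZMod 2} {x : V} (hx : x ∈ (part i : Submodule ℂ V))
    (u v : SuperClifford β) :
    tau β (wedge β x u * v) = tau β (twist β i u * contract β β x v) := by
  rw [wedge_apply, sub_mul, map_sub, mul_assoc, tau_ι_mul, contract_mul β hx, map_add,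
    add_sub_cancel_left]

variable (β) in
/-- The element of the Clifford algebra that corresponds to `a ∧ b`. -/
def wedgeTwo : V →ₗ[ℂ] V →ₗ[ℂ] SuperClifford β :=
  (wedge β).compl₂ (SuperClifford.ι β)

theorem wedgeTwo_apply (a b : V) : wedgeTwo β a b = wedge β a (SuperClifford.ι β b) := rfl

theorem wedgeTwo_eq (a b : V) : wedgeTwo β a b =
    SuperClifford.ι β a * SuperClifford.ι β b - β.toBilin a b • (1 : SuperClifford β) := by
  rw [wedgeTwo_apply, wedge_apply, contract_ι]

theorem eta_ι (x : V) : eta β (SuperClifford.ι β x) = extι V x := by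
  have := eta_ι_mul (β := β) x 1
  rwa [mul_one, eta_one, contract_one, mul_one, add_zero] at this

theorem eta_wedgeTwo (a b : V) : eta β (wedgeTwo β a b) = extι V a * extι V b := by
  rw [wedgeTwo_apply, eta_wedge, eta_ι]

theorem tau_wedgeTwo (a b : V) : tau β (wedgeTwo β a b) = 0 := by
  rw [tau_apply, eta_wedgeTwo, map_mul, aug, lift_ι]
  simp

theorem twist_zero_wedgeTwo (a b : V) : twist β 0 (wedgeTwo β a b) = wedgeTwo β a b := by
  rw [wedgeTwo_eq, map_sub, map_mul, map_smul, map_one, twist_zero_ι, twist_zero_ι, neg_mul_neg]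

theorem wedgeTwo_mem {i j : ZMod 2} {a b : V} (ha : a ∈ (part i : Submodule ℂ V))
    (hb : b ∈ (part j : Submodule ℂ V)) : wedgeTwo β a b ∈ grading β (i + j) := by
  rw [wedgeTwo_eq]
  refine sub_mem (mul_mem_grading (ι_mem ha) (ι_mem hb)) ?_
  rcases eq_or_ne i j with rfl | h
  · rw [CharTwo.add_self_eq_zero]
    exact Submodule.smul_mem _ _ one_mem_grading
  · rw [β.apply_eq_zero h ha hb, zero_smul]
    exact zero_mem _

theorem IsBihom.wedgeTwo {i j : ZMod 2} {a b : V} (ha : a ∈ (part i : Submodule ℂ V))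
    (hb : b ∈ (part j : Submodule ℂ V)) : IsBihom (i + j) 1 (wedgeTwo β a b) :=
  ⟨wedgeTwo_mem ha hb, by rw [twist_zero_wedgeTwo, one_smul]⟩

theorem wedgeTwo_comm {i j : ZMod 2} {a b : V} (ha : a ∈ (part i : Submodule ℂ V))
    (hb : b ∈ (part j : Submodule ℂ V)) :
    SuperClifford.wedgeTwo β a b = -(ksign i j • SuperClifford.wedgeTwo β b a) := by
  apply (eta β).injective
  rw [map_neg, map_smul, eta_wedgeTwo, eta_wedgeTwo, extι_mul_comm ha hb]

theorem contract_wedgeTwo {i j : ZMod 2} {z a : V} (hz : z ∈ (part i : Submodule ℂ V))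
    (ha : a ∈ (part j : Submodule ℂ V)) (b : V) :
    contract β β z (SuperClifford.wedgeTwo β a b) = β.toBilin z a • SuperClifford.ι β b -
      (ksign i j * β.toBilin z b) • SuperClifford.ι β a := by
  rw [wedgeTwo_apply, contract_wedge hz ha, contract_ι, map_smul, wedge_apply, contract_one,
    mul_one, sub_zero, smul_smul]

theorem tau_wedgeTwo_mul {i j : ZMod 2} {a b : V} (ha : a ∈ (part i : Submodule ℂ V))
    (hb : b ∈ (part j : Submodule ℂ V)) (v : SuperClifford β) :
    tau β (SuperClifford.wedgeTwo β a b * v) = tau β (contract β β a (contract β β b v)) := by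
  rw [wedgeTwo_apply, tau_wedge_mul ha, twist_ι i hb, neg_mul, smul_mul_assoc, map_neg, map_smul,
    tau_ι_mul, ← map_smul, ← map_neg]
  congr 1
  linear_combination (norm := module) -contract_anticomm β β ha hb v

end SuperClifford

/-! ### The image of the orthosymplectic Lie superalgebra in the Clifford algebra -/

section Skew

variable {V : Type*} [AddCommGroup V] [Module ℂ V] [SuperSpace V] {β : SuperForm V}

/-- Super-skew operators of parity `t`. -/
structure SuperForm.IsSkew (β : SuperForm V) (t : ZMod 2) (T : V →ₗ[ℂ] V) : Prop where
  mem : ∀ i, ∀ x ∈ (part i : Submodule ℂ V), T x ∈ (part (t + i) : Submodule ℂ V)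
  skew : ∀ i, ∀ x ∈ (part i : Submodule ℂ V), ∀ y,
    β.toBilin (T x) y = -(ksign t i * β.toBilin x (T y))

namespace SuperForm.IsSkew

variable {I : Type*} [Fintype I] {par : I → ZMod 2} {b b' : I → V} {t : ZMod 2} {T : V →ₗ[ℂ] V}

theorem skew' (hT : β.IsSkew t T) {i : ZMod 2} {x : V} (hx : x ∈ (part i : Submodule ℂ V))
    (y : V) : β.toBilin x (T y) = -(ksign t i * β.toBilin (T x) y) := by
  rw [hT.skew i x hx, mul_neg, ← mul_assoc, ksign_mul_self]
  ring

/-- The tensor ∑ bᵢ ⊗ b'ᵢ is dual to the form, which T preserves infinitesimally, so T annihilates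
the tensor. -/
theorem sum_apply_right (hT : β.IsSkew t T) (h : β.IsHomFrame par b b') {M : Type*}
    [AddCommGroup M] [Module ℂ M] (B : V →ₗ[ℂ] V →ₗ[ℂ] M) :
    ∑ i, ksign t (par i) • B (b i) (T (b' i)) = -∑ i, B (T (b i)) (b' i) := by
  have h1 : ∀ i, ksign t (par i) • B (b i) (T (b' i)) =
      ∑ j, -(β.toBilin (b' i) (T (b j)) • B (b i) (b' j)) := by
    intro i
    rw [← h.sum_apply' (B (b i)) (T (b' i)), Finset.smul_sum]
    refine Finset.sum_congr rfl fun j _ => ?_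
    rw [hT.skew _ _ (h.mem' i), smul_smul, mul_neg, ← mul_assoc, ksign_mul_self, one_mul, neg_smul]
  simp_rw [h1]
  rw [Finset.sum_comm, ← Finset.sum_neg_distrib]
  refine Finset.sum_congr rfl fun j _ => ?_
  rw [Finset.sum_neg_distrib]
  exact congrArg _ (h.sum_apply (B.flip (b' j)) (T (b j)))

end SuperForm.IsSkew

namespace SuperClifford

variable {I : Type*} [Fintype I] {par : I → ZMod 2} {b b' : I → V} {s t : ZMod 2}
  {S T : V →ₗ[ℂ] V}

/-- These are the only properties of Λ² used for uniqueness: the degree is even and the scalar part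
is zero. -/
theorem twist_zero_and_tau_of_mem_extPower {u : SuperClifford β}
    (hu : eta β u ∈ extPower V 2) : twist β 0 u = u ∧ tau β u = 0 := by
  have key : ∀ w ∈ extPower V 2, twist β 0 ((eta β).symm w) = (eta β).symm w ∧
      tau β ((eta β).symm w) = 0 := by
    intro w hw
    rw [extPower, pow_two] at hw
    induction hw using Submodule.mul_induction_on' with
    | mem_mul_mem x hx y hy =>
      obtain ⟨x, rfl⟩ := hx
      obtain ⟨y, rfl⟩ := hy
      have : (eta β).symm (extι V x * extι V y) = wedgeTwo β x y := by
        rw [← eta_wedgeTwo, LinearEquiv.symm_apply_apply]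
      rw [this]
      exact ⟨twist_zero_wedgeTwo x y, tau_wedgeTwo x y⟩
    | add u _ v _ h1 h2 =>
      rw [map_add, map_add, map_add, h1.1, h2.1, h1.2, h2.2, add_zero]
      exact ⟨rfl, rfl⟩
  simpa using key _ hu

variable (β) in
/-- The map from linear operators to the second exterior power, viewed in the Clifford algebra,
under which commutators with the image of a super-skew operator `T` induce `T`. -/
def nu (b b' : I → V) : (V →ₗ[ℂ] V) →ₗ[ℂ] SuperClifford β :=
  (1 / 4 : ℂ) • ∑ i, (wedgeTwo β).flip (b' i) ∘ₗ LinearMap.applyₗ (b i)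

theorem nu_apply (T : V →ₗ[ℂ] V) :
    nu β b b' T = (1 / 4 : ℂ) • ∑ i, wedgeTwo β (T (b i)) (b' i) := by
  simp [nu]

theorem eta_nu_mem (T : V →ₗ[ℂ] V) : eta β (nu β b b' T) ∈ extPower V 2 := by
  rw [nu_apply, map_smul, map_sum, extPower, pow_two]
  refine Submodule.smul_mem _ _ (Submodule.sum_mem _ fun i _ => ?_)
  rw [eta_wedgeTwo]
  exact Submodule.mul_mem_mul ⟨_, rfl⟩ ⟨_, rfl⟩

theorem isBihom_nu (h : β.IsHomFrame par b b') (hT : β.IsSkew t T) :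
    IsBihom t 1 (nu β b b' T) where
  mem := by
    rw [nu_apply]
    refine Submodule.smul_mem _ _ (Submodule.sum_mem _ fun i _ => ?_)
    have := wedgeTwo_mem (β := β) (hT.mem _ _ (h.mem i)) (h.mem' i)
    rwa [add_assoc, CharTwo.add_self_eq_zero, add_zero] at this
  deg := by rw [(twist_zero_and_tau_of_mem_extPower (eta_nu_mem T)).1, one_smul]

/-- Contracting either factor of T(bᵢ) ∧ b'ᵢ reproduces T z, by skewness and by the frame expansion
respectively. The two equal terms turn 1/4 into 1/2. -/
theorem contract_nu (h : β.IsHomFrame par b b') (hT : β.IsSkew t T) {j : ZMod 2} {z : V}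
    (hz : z ∈ (part j : Submodule ℂ V)) :
    contract β β z (nu β b b' T) = -((1 / 2 * ksign t j : ℂ) • ι β (T z)) := by
  have h1 : ∀ i, contract β β z (wedgeTwo β (T (b i)) (b' i)) =
      -(ksign t j • (β.toBilin (T z) (b i) • ι β (b' i))) -
        ksign t j • (β.toBilin (b' i) z • ι β (T (b i))) := by
    intro i
    rw [contract_wedgeTwo hz (hT.mem _ _ (h.mem i)), hT.skew' hz, ksign_add_right,
      β.supersymm _ _ _ (h.mem' i) _ hz, ksign_comm j t, ksign_comm j (par i)]
    module
  have h2 := h.sum_apply' (ι β) (T z)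
  have h3 := h.sum_apply (ι β ∘ₗ T) z
  simp only [LinearMap.comp_apply] at h3
  rw [nu_apply, map_smul, map_sum]
  simp_rw [h1]
  rw [Finset.sum_sub_distrib, Finset.sum_neg_distrib, ← Finset.smul_sum, ← Finset.smul_sum, h2, h3]
  module

theorem nu_mul_ι (h : β.IsHomFrame par b b') (hT : β.IsSkew t T) {j : ZMod 2} {z : V}
    (hz : z ∈ (part j : Submodule ℂ V)) :
    nu β b b' T * ι β z - ksign t j • (ι β z * nu β b b' T) = ι β (T z) := by
  have h1 := (isBihom_nu h hT).two_smul_contract hz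
  rw [contract_nu h hT hz, mul_one, ksign_comm j t] at h1
  have h2 := congrArg (fun c : ℂ => c • ι β (T z)) (ksign_mul_self t j)
  have h3 := congrArg (fun c : ℂ => c • (nu β b b' T * ι β z)) (ksign_mul_self t j)
  linear_combination (norm := module) ksign t j • h1 + h2 - h3

theorem nu_mul_wedgeTwo (h : β.IsHomFrame par b b') (hT : β.IsSkew t T) {i j : ZMod 2} {x y : V}
    (hx : x ∈ (part i : Submodule ℂ V)) (hy : y ∈ (part j : Submodule ℂ V)) :
    nu β b b' T * wedgeTwo β x y - ksign t (i + j) • (wedgeTwo β x y * nu β b b' T) =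
      wedgeTwo β (T x) y + ksign t i • wedgeTwo β x (T y) := by
  have h1 := congrArg (· * ι β y) (nu_mul_ι h hT hx)
  have h2 := congrArg (ι β x * ·) (nu_mul_ι h hT hy)
  simp only [sub_mul, smul_mul_assoc, mul_sub, mul_smul_comm, mul_assoc] at h1 h2
  -- The scalar (x, y) separating the wedge from the product drops out of the commutator: it is
  -- nonzero only for equal parities, where the sign is 1. On the right side the scalar corrections
  -- cancel by skewness.
  have h3 : (1 - ksign t (i + j)) • β.toBilin x y • nu β b b' T = 0 := by
    rcases eq_or_ne i j with rfl | e
    · rw [CharTwo.add_self_eq_zero, ksign_zero_right, sub_self, zero_smul]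
    · rw [β.apply_eq_zero e hx hy, zero_smul, smul_zero]
  simp only [wedgeTwo_eq, mul_sub, sub_mul, mul_smul_comm, smul_mul_assoc, mul_one, one_mul,
    hT.skew i x hx, mul_assoc]
  rw [ksign_add_right] at h3 ⊢
  linear_combination (norm := module) h1 + ksign t i • h2 - h3

/-- The commutator with ν(T) acts on ∑ S(bᵢ) ∧ b'ᵢ as a derivation. Moving T from b'ᵢ over to bᵢ by
`sum_apply_right` turns the second term into the one with S T. -/
theorem nu_commutator (h : β.IsHomFrame par b b') (hT : β.IsSkew t T) (hS : β.IsSkew s S) :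
    nu β b b' T * nu β b b' S - ksign t s • (nu β b b' S * nu β b b' T) =
      nu β b b' (T ∘ₗ S - ksign t s • (S ∘ₗ T)) := by
  have h1 : ∀ i, nu β b b' T * wedgeTwo β (S (b i)) (b' i) -
      ksign t s • (wedgeTwo β (S (b i)) (b' i) * nu β b b' T) =
        wedgeTwo β (T (S (b i))) (b' i) +
          ksign t s • (ksign t (par i) • wedgeTwo β (S (b i)) (T (b' i))) := by
    intro i
    have := nu_mul_wedgeTwo h hT (hS.mem _ _ (h.mem i)) (h.mem' i)
    rwa [add_assoc s, CharTwo.add_self_eq_zero, add_zero, ksign_add_right, mul_smul] at this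
  have h2 := hT.sum_apply_right h (wedgeTwo β ∘ₗ S)
  simp only [LinearMap.comp_apply] at h2
  have h3 := Finset.sum_congr (rfl : Finset.univ = (Finset.univ : Finset I)) fun i _ => h1 i
  rw [Finset.sum_sub_distrib, Finset.sum_add_distrib, ← Finset.smul_sum, ← Finset.smul_sum, h2,
    ← Finset.mul_sum, ← Finset.sum_mul] at h3
  rw [map_sub, map_smul, nu_apply S, nu_apply (T ∘ₗ S), nu_apply (S ∘ₗ T)]
  simp only [LinearMap.comp_apply, mul_smul_comm, smul_mul_assoc]
  linear_combination (norm := module) (1 / 4 : ℂ) • h3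

theorem tau_nu_mul_nu (h : β.IsHomFrame par b b') (hT : β.IsSkew t T) (hS : β.IsSkew s S) :
    tau β (nu β b b' T * nu β b b' S) =
      -(1 / 8) * ∑ i, ksign s (par i) * β.toBilin (T (b i)) (S (b' i)) := by
  rw [nu_apply T, smul_mul_assoc, Finset.sum_mul, map_smul, map_sum, smul_eq_mul, Finset.mul_sum,
    Finset.mul_sum]
  refine Finset.sum_congr rfl fun i _ => ?_
  rw [tau_wedgeTwo_mul (hT.mem _ _ (h.mem i)) (h.mem' i), contract_nu h hS (h.mem' i), map_neg,
    map_smul, contract_ι, map_neg, map_smul, map_smul, tau_one]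
  simp only [smul_eq_mul]
  ring

end SuperClifford

end Skew

/-! ### The projected adjoint action and the cubic element -/

namespace SuperClifford

variable {V : Type*} [AddCommGroup V] [Module ℂ V] [SuperSpace V] {β : SuperForm V}

theorem IsBihom.smul {i : ZMod 2} {e : ℂ} {u : SuperClifford β} (h : IsBihom i e u) (c : ℂ) :
    IsBihom i e (c • u) :=
  ⟨Submodule.smul_mem _ _ h.mem, by rw [map_smul, h.deg, smul_comm]⟩

theorem IsBihom.sum {I : Type*} {s : Finset I} {i : ZMod 2} {e : ℂ} {u : I → SuperClifford β}
    (h : ∀ k ∈ s, IsBihom i e (u k)) : IsBihom i e (∑ k ∈ s, u k) :=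
  ⟨Submodule.sum_mem _ fun k hk => (h k hk).mem, by
    rw [map_sum, Finset.smul_sum]
    exact Finset.sum_congr rfl fun k hk => (h k hk).deg⟩

theorem IsBihom.wedge_wedgeTwo {i j k : ZMod 2} {a b c : V} (ha : a ∈ (part i : Submodule ℂ V))
    (hb : b ∈ (part j : Submodule ℂ V)) (hc : c ∈ (part k : Submodule ℂ V)) :
    IsBihom (i + (j + k)) (-1) (wedge β a (SuperClifford.wedgeTwo β b c)) where
  mem := by
    rw [wedge_apply, contract_wedgeTwo ha hb]
    refine sub_mem (mul_mem_grading (ι_mem ha) (wedgeTwo_mem hb hc)) (sub_mem ?_ ?_)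
    · rcases eq_or_ne i j with rfl | e
      · rw [← add_assoc, CharTwo.add_self_eq_zero, zero_add]
        exact Submodule.smul_mem _ _ (ι_mem hc)
      · rw [β.apply_eq_zero e ha hb, zero_smul]
        exact zero_mem _
    · rcases eq_or_ne i k with rfl | e
      · rw [add_comm, add_assoc, CharTwo.add_self_eq_zero, add_zero]
        exact Submodule.smul_mem _ _ (ι_mem hb)
      · rw [β.apply_eq_zero e ha hc, mul_zero, zero_smul]
        exact zero_mem _
  deg := by
    rw [wedge_apply, contract_wedgeTwo ha hb]
    simp only [map_sub, map_mul, map_smul, twist_zero_ι, twist_zero_wedgeTwo]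
    rw [neg_mul]
    module

end SuperClifford

section Adjoint

open SuperClifford LieSuperalgebra

theorem SuperForm.restrict_apply {V : Type*} [AddCommGroup V] [Module ℂ V] [SuperSpace V]
    (β : SuperForm V) (W : Submodule ℂ V) [IsSuperSubspace W] (a b : W) :
    (β.restrict W).toBilin a b = β.toBilin (a : V) (b : V) := rfl

theorem coe_mem_part {V : Type*} [AddCommGroup V] [Module ℂ V] [SuperSpace V]
    {W : Submodule ℂ V} [IsSuperSubspace W] {i : ZMod 2} {w : W}
    (hw : w ∈ (part i : Submodule ℂ W)) : (w : V) ∈ (part i : Submodule ℂ V) := hw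

variable {g : Type*} [AddCommGroup g] [Module ℂ g] [LieSuperalgebra g] {β : SuperForm g}
  {r : Submodule ℂ g} [IsLieSubsuperalgebra r] {J K : Type*} [Fintype J] [Fintype K]
  {parx : J → ZMod 2} {x x' : J → r} {par : K → ZMod 2} {y y' : K → perp β r}

/-- The projected adjoint action `v ↦ [w, v]_p` of `g` on the orthogonal complement `p`. -/
def adP (y y' : K → perp β r) : g →ₗ[ℂ] (perp β r →ₗ[ℂ] perp β r) where
  toFun w := frameProj β y y' ∘ₗ LieSuperalgebra.bracket w ∘ₗ (perp β r).subtype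
  map_add' a b := by ext v; simp
  map_smul' c a := by ext v; simp

set_option linter.unusedSectionVars false in
theorem adP_apply (w : g) (v : perp β r) :
    adP y y' w v = frameProj β y y' (bracket w (v : g)) := rfl

theorem adP_mem (hy : (β.restrict (perp β r)).IsHomFrame par y y') {i j : ZMod 2} {w : g}
    {v : perp β r} (hw : w ∈ (part i : Submodule ℂ g))
    (hv : v ∈ (part j : Submodule ℂ (perp β r))) :
    adP y y' w v ∈ (part (i + j) : Submodule ℂ (perp β r)) :=
  frameProj_mem hy (LieSuperalgebra.bracket_mem _ _ _ hw _ hv)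

theorem apply_adP (hy : (β.restrict (perp β r)).IsFrame y y') (w : g) (u v : perp β r) :
    β.toBilin (u : g) (adP y y' w v) = β.toBilin (u : g) (bracket w (v : g)) :=
  apply_frameProj hy u _

theorem adP_apply_left (hy : (β.restrict (perp β r)).IsFrame y y') (w : g) (u v : perp β r) :
    β.toBilin (adP y y' w u) (v : g) = β.toBilin (bracket w (u : g)) (v : g) :=
  frameProj_apply_left hy v _

theorem adP_comm {i j : ZMod 2} {u v : perp β r} (hu : u ∈ (part i : Submodule ℂ (perp β r)))
    (hv : v ∈ (part j : Submodule ℂ (perp β r))) :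
    adP y y' (u : g) v = -(ksign i j • adP y y' (v : g) u) := by
  rw [adP_apply, LieSuperalgebra.bracket_skew _ _ _ (coe_mem_part hu) _ (coe_mem_part hv),
    map_neg, map_smul]
  rfl

theorem adP_eq_actP (hinv : β.IsInvariant) (hy : (β.restrict (perp β r)).IsFrame y y') (w : r)
    (v : perp β r) : adP y y' (w : g) v = actP hinv w v :=
  frameProj_coe hy (actP hinv w v)

/-- The projection to p disappears when paired with vectors of p, so skewness follows from
invariance for every w in g, not only for w in r. -/
theorem isSkew_adP (hinv : β.IsInvariant) (hy : (β.restrict (perp β r)).IsHomFrame par y y')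
    {t : ZMod 2} {w : g} (hw : w ∈ (part t : Submodule ℂ g)) :
    (β.restrict (perp β r)).IsSkew t (adP y y' w) where
  mem i v hv := adP_mem hy hw hv
  skew i u hu v := by
    rw [SuperForm.restrict_apply, SuperForm.restrict_apply, adP_apply_left hy.toIsFrame,
      apply_adP hy.toIsFrame, LieSuperalgebra.bracket_skew _ _ _ hw _ (coe_mem_part hu), ← hinv]
    simp

/-- The linear map `g → Λ²(p) ⊂ C(p)`, `w ↦ ν([w, ·]_p)`. -/
def spin (y y' : K → perp β r) : g →ₗ[ℂ] CliffordP β r :=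
  nu (β.restrict (perp β r)) y y' ∘ₗ adP y y'

theorem spin_apply (w : g) :
    spin y y' w = nu (β.restrict (perp β r)) y y' (adP y y' w) := rfl

theorem isBihom_spin (hinv : β.IsInvariant) (hy : (β.restrict (perp β r)).IsHomFrame par y y')
    {t : ZMod 2} {w : g} (hw : w ∈ (part t : Submodule ℂ g)) : IsBihom t 1 (spin y y' w) :=
  isBihom_nu hy (isSkew_adP hinv hy hw)

theorem contract_spin (hinv : β.IsInvariant) (hy : (β.restrict (perp β r)).IsHomFrame par y y')
    {i j : ZMod 2} {w : g} (hw : w ∈ (part i : Submodule ℂ g)) {z : perp β r}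
    (hz : z ∈ (part j : Submodule ℂ (perp β r))) :
    contract _ (β.restrict (perp β r)) z (spin y y' w) =
      -((1 / 2 * ksign i j : ℂ) • ιP β r (adP y y' w z)) :=
  contract_nu hy (isSkew_adP hinv hy hw) hz

theorem sum_wedgeTwo_adP (w : g) :
    ∑ i, wedgeTwo (β.restrict (perp β r)) (adP y y' w (y i)) (y' i) =
      (4 : ℂ) • spin y y' w := by
  rw [spin_apply, nu_apply, smul_smul]
  norm_num

variable (β r) in
/-- The cubic element, as an element of the Clifford algebra. -/
def cubic (par : K → ZMod 2) (y y' : K → perp β r) : CliffordP β r :=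
  (eta (β.restrict (perp β r))).symm (cubicElement β r par y y')

/-- The sum over k reassembles [yᵢ, yⱼ]_p. Bringing it to the front and exchanging yⁱ with yʲ takes
three transpositions: they change -1/12 to 1/12, and their Koszul signs cancel those of the
definition. -/
theorem cubic_eq (hy : (β.restrict (perp β r)).IsHomFrame par y y') :
    cubic β r par y y' = (1 / 12 : ℂ) • ∑ i, ∑ j, wedge (β.restrict (perp β r))
      (adP y y' (y i : g) (y j)) (wedgeTwo (β.restrict (perp β r)) (y' j) (y' i)) := by
  apply (eta (β.restrict (perp β r))).injective
  rw [cubic, LinearEquiv.apply_symm_apply, map_smul, map_sum, cubicElement]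
  simp_rw [map_sum, eta_wedge, eta_wedgeTwo]
  have h1 : ∀ i j, ∑ k, (ksign (par i) (par j) * ksign (par k) (par k) *
        β.toBilin (bracket (y i : g) (y j : g)) (y k : g)) •
      (extι (perp β r) (y' i) * extι (perp β r) (y' j) * extι (perp β r) (y' k)) =
        -(extι (perp β r) (adP y y' (y i : g) (y j)) *
          (extι (perp β r) (y' j) * extι (perp β r) (y' i))) := by
    intro i j
    have hb := adP_mem hy (coe_mem_part (hy.mem i)) (hy.mem j)
    have h2 := hy.sum_apply_par' hb
      (fun k => ksign k k • (LinearMap.mulLeft ℂ (extι (perp β r) (y' i) *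
        extι (perp β r) (y' j)) ∘ₗ extι (perp β r)))
    simp only [LinearMap.smul_apply, LinearMap.comp_apply, LinearMap.mulLeft_apply,
      SuperForm.restrict_apply, adP_apply_left hy.toIsFrame] at h2
    have h3 := congrArg (ksign (par i) (par j) • ·) h2
    simp only [Finset.smul_sum, smul_smul] at h3
    refine (Finset.sum_congr rfl fun k _ => ?_).trans (h3.trans ?_)
    · congr 1
      ring
    · rw [mul_assoc, extι_mul_comm (hy.mem' j) hb, mul_neg, mul_smul_comm, ← mul_assoc,
        extι_mul_comm (hy.mem' i) hb, neg_mul, smul_mul_assoc, mul_assoc,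
        extι_mul_comm (hy.mem' i) (hy.mem' j)]
      simp only [mul_neg, mul_smul_comm]
      generalize extι (perp β r) (adP y y' (y i : g) (y j)) *
          (extι (perp β r) (y' j) * extι (perp β r) (y' i)) = w
      rcases zmod2_cases (par i) with e | e <;> rcases zmod2_cases (par j) with e' | e' <;>
        simp [e, e', CharTwo.add_self_eq_zero]
  simp_rw [h1]
  simp only [Finset.sum_neg_distrib]
  module

theorem isBihom_cubic (hy : (β.restrict (perp β r)).IsHomFrame par y y') :
    IsBihom 0 (-1) (cubic β r par y y') := by
  rw [cubic_eq hy]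
  refine IsBihom.smul (IsBihom.sum fun i _ => IsBihom.sum fun j _ => ?_) _
  have := IsBihom.wedge_wedgeTwo (β := β.restrict (perp β r))
    (adP_mem hy (coe_mem_part (hy.mem i)) (hy.mem j))
    (hy.mem' j) (hy.mem' i)
  rwa [add_comm (par j), CharTwo.add_self_eq_zero] at this

/-- Contracting each of the three factors gives the same sum ∑ [z, yᵢ]_p ∧ yⁱ = 4 `spin z`, by
invariance and skewness of the bracket. Hence the normalisation 1/12. -/
theorem contract_cubic (hinv : β.IsInvariant)
    (hy : (β.restrict (perp β r)).IsHomFrame par y y') {k : ZMod 2} {z : perp β r}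
    (hz : z ∈ (part k : Submodule ℂ (perp β r))) :
    contract _ (β.restrict (perp β r)) z (cubic β r par y y') = spin y y' (z : g) := by
  have h1 : ∀ i j, contract _ (β.restrict (perp β r)) z (wedge (β.restrict (perp β r))
      (adP y y' (y i : g) (y j)) (wedgeTwo (β.restrict (perp β r)) (y' j) (y' i))) =
      (β.restrict (perp β r)).toBilin (adP y y' (z : g) (y i)) (y j) •
        wedgeTwo (β.restrict (perp β r)) (y' j) (y' i) -
      ksign k (par i) • ((β.restrict (perp β r)).toBilin (y' j) z •
        wedgeTwo (β.restrict (perp β r)) (adP y y' (y i : g) (y j)) (y' i)) +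
      (β.restrict (perp β r)).toBilin (y' i) z •
        wedgeTwo (β.restrict (perp β r)) (adP y y' (y i : g) (y j)) (y' j) := by
    intro i j
    have e1 : (β.restrict (perp β r)).toBilin z (adP y y' (y i : g) (y j)) =
        (β.restrict (perp β r)).toBilin (adP y y' (z : g) (y i)) (y j) := by
      rw [SuperForm.restrict_apply, SuperForm.restrict_apply, apply_adP hy.toIsFrame,
        adP_apply_left hy.toIsFrame, hinv]
    rw [contract_wedge hz (adP_mem hy (coe_mem_part (hy.mem i)) (hy.mem j)),
      contract_wedgeTwo hz (hy.mem' j),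
      e1, map_sub, map_smul, map_smul, ← wedgeTwo_apply, ← wedgeTwo_apply, ksign_add_right,
      (β.restrict (perp β r)).supersymm _ _ _ (hy.mem' j) _ hz,
      (β.restrict (perp β r)).supersymm _ _ _ (hy.mem' i) _ hz, ksign_comm (par i),
      ksign_comm (par j)]
    have e2 := congrArg (fun c : ℂ => (c * ksign k (par i) *
      (β.restrict (perp β r)).toBilin z (y' i)) •
        wedgeTwo (β.restrict (perp β r)) (adP y y' (y i : g) (y j)) (y' j))
      (ksign_mul_self k (par j))
    linear_combination (norm := module) e2
  have s1 : ∀ i, ∑ j, (β.restrict (perp β r)).toBilin (adP y y' (z : g) (y i)) (y j) •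
        wedgeTwo (β.restrict (perp β r)) (y' j) (y' i) =
      wedgeTwo (β.restrict (perp β r)) (adP y y' (z : g) (y i)) (y' i) := fun i =>
    hy.sum_apply' ((wedgeTwo (β.restrict (perp β r))).flip (y' i)) _
  have s2 : ∀ i, ∑ j, ksign k (par i) • ((β.restrict (perp β r)).toBilin (y' j) z •
        wedgeTwo (β.restrict (perp β r)) (adP y y' (y i : g) (y j)) (y' i)) =
      -wedgeTwo (β.restrict (perp β r)) (adP y y' (z : g) (y i)) (y' i) := fun i => by
    have := hy.sum_apply ((wedgeTwo (β.restrict (perp β r))).flip (y' i) ∘ₗ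
      adP y y' (y i : g)) z
    simp only [LinearMap.comp_apply, LinearMap.flip_apply] at this
    rw [← Finset.smul_sum, this, adP_comm hz (hy.mem i), map_neg, map_smul, LinearMap.neg_apply,
      LinearMap.smul_apply, neg_neg]
  have s3 : ∀ j, ∑ i, (β.restrict (perp β r)).toBilin (y' i) z •
        wedgeTwo (β.restrict (perp β r)) (adP y y' (y i : g) (y j)) (y' j) =
      wedgeTwo (β.restrict (perp β r)) (adP y y' (z : g) (y j)) (y' j) := fun j =>
    hy.sum_apply ((wedgeTwo (β.restrict (perp β r))).flip (y' j) ∘ₗ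
      LinearMap.applyₗ (y j) ∘ₗ adP y y' ∘ₗ (perp β r).subtype) z
  rw [cubic_eq hy, map_smul, map_sum]
  simp_rw [map_sum, h1, Finset.sum_add_distrib, Finset.sum_sub_distrib, s1, s2]
  rw [Finset.sum_comm (s := Finset.univ) (t := Finset.univ)]
  simp_rw [s3]
  rw [Finset.sum_neg_distrib, sum_wedgeTwo_adP]
  module

end Adjoint

section Square

open SuperClifford LieSuperalgebra

variable {g : Type*} [AddCommGroup g] [Module ℂ g] [LieSuperalgebra g] {β : SuperForm g}
  {r : Submodule ℂ g} [IsLieSubsuperalgebra r] {J K : Type*} [Fintype J] [Fintype K]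
  {parx : J → ZMod 2} {x x' : J → r} {par : K → ZMod 2} {y y' : K → perp β r}

/-! ### The square of the cubic element is a scalar up to the Casimir element of the spin action -/

theorem frameProj_bracket_comm {i a : ZMod 2} {u : perp β r} {w : g}
    (hu : u ∈ (part i : Submodule ℂ (perp β r))) (hw : w ∈ (part a : Submodule ℂ g)) :
    frameProj β y y' (bracket (u : g) w) = -(ksign a i • adP y y' w u) := by
  rw [bracket_skew _ _ _ (coe_mem_part hu) _ hw, map_neg, map_smul, ksign_comm]
  rfl

theorem adP_adP (hx : (β.restrict r).IsFrame x x') (hy : (β.restrict (perp β r)).IsFrame y y')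
    (u v : g) (w : perp β r) :
    adP y y' u (adP y y' v w) = frameProj β y y' (bracket u (bracket v (w : g))) -
      frameProj β y y' (bracket u (frameProj β x x' (bracket v (w : g)) : g)) := by
  have h := frameProj_add_frameProj hx hy (bracket v (w : g))
  conv_rhs => enter [1]; rw [← h]
  rw [map_add, map_add, add_sub_cancel_left]
  rfl

/-- The r-component of [v, yᵢ] has coefficients (xᵃ, [v, yᵢ]) = ([xᵃ, v], yᵢ), so the sum over i
reassembles [xᵃ, v]. -/
theorem sum_wedgeTwo_bracket_frameProj (hinv : β.IsInvariant)
    (hy : (β.restrict (perp β r)).IsFrame y y') (u : g) (v : perp β r) :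
    ∑ i, wedgeTwo (β.restrict (perp β r))
      (frameProj β y y' (bracket u (frameProj β x x' (bracket (v : g) (y i : g)) : g))) (y' i) =
    ∑ a, wedgeTwo (β.restrict (perp β r)) (frameProj β y y' (bracket u (x a : g)))
      (adP y y' (x' a : g) v) := by
  have h1 : ∀ a, wedgeTwo (β.restrict (perp β r)) (frameProj β y y' (bracket u (x a : g)))
      (adP y y' (x' a : g) v) = ∑ i, β.toBilin (x' a : g) (bracket (v : g) (y i : g)) •
        wedgeTwo (β.restrict (perp β r)) (frameProj β y y' (bracket u (x a : g))) (y' i) := by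
    intro a
    rw [← hy.sum_apply' (wedgeTwo (β.restrict (perp β r))
      (frameProj β y y' (bracket u (x a : g)))) (adP y y' (x' a : g) v)]
    refine Finset.sum_congr rfl fun i _ => ?_
    rw [SuperForm.restrict_apply, adP_apply_left hy, hinv]
  simp_rw [h1]
  rw [Finset.sum_comm]
  refine Finset.sum_congr rfl fun i _ => ?_
  rw [frameProj_apply (bracket (v : g) (y i : g)), Submodule.coe_sum, map_sum, map_sum,
    map_sum, LinearMap.sum_apply]
  refine Finset.sum_congr rfl fun a _ => ?_
  simp

/-- By the Jacobi identity, the failure of w ↦ [w, ·]_p to be a representation consists of the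
r-components discarded between two brackets. This expresses it through the action of r alone, in the
shape in which double contraction of ∑ ν(xₐ)ν(xᵃ) produces it. -/
theorem nu_adP_curvature (hinv : β.IsInvariant) (hx : (β.restrict r).IsHomFrame parx x x')
    (hy : (β.restrict (perp β r)).IsHomFrame par y y') {i j : ZMod 2} {u v : perp β r}
    (hu : u ∈ (part i : Submodule ℂ (perp β r))) (hv : v ∈ (part j : Submodule ℂ (perp β r))) :
    nu (β.restrict (perp β r)) y y' (adP y y' (u : g) ∘ₗ adP y y' (v : g) -
      ksign i j • (adP y y' (v : g) ∘ₗ adP y y' (u : g)) - adP y y' (bracket (u : g) (v : g))) =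
    (1 / 4 : ℂ) • (∑ a, ksign (parx a) i • wedgeTwo (β.restrict (perp β r))
        (adP y y' (x a : g) u) (adP y y' (x' a : g) v) -
      ksign i j • ∑ a, ksign (parx a) j • wedgeTwo (β.restrict (perp β r))
        (adP y y' (x a : g) v) (adP y y' (x' a : g) u)) := by
  have h1 : ∀ k, (adP y y' (u : g) ∘ₗ adP y y' (v : g) -
      ksign i j • (adP y y' (v : g) ∘ₗ adP y y' (u : g)) -
        adP y y' (bracket (u : g) (v : g))) (y k) =
      ksign i j • frameProj β y y'
        (bracket (v : g) (frameProj β x x' (bracket (u : g) (y k : g)) : g)) -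
      frameProj β y y' (bracket (u : g) (frameProj β x x' (bracket (v : g) (y k : g)) : g)) := by
    intro k
    simp only [LinearMap.sub_apply, LinearMap.smul_apply, LinearMap.comp_apply,
      adP_adP hx.toIsFrame hy.toIsFrame]
    rw [jacobi _ _ _ _ (coe_mem_part hu) _ (coe_mem_part hv) _ (coe_mem_part (hy.mem k)), map_add,
      map_smul, adP_apply]
    module
  have h2 : ∀ {i : ZMod 2} {u : perp β r} (v : perp β r),
      u ∈ (part i : Submodule ℂ (perp β r)) →
      ∑ k, wedgeTwo (β.restrict (perp β r)) (frameProj β y y'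
        (bracket (u : g) (frameProj β x x' (bracket (v : g) (y k : g)) : g))) (y' k) =
      -∑ a, ksign (parx a) i • wedgeTwo (β.restrict (perp β r))
        (adP y y' (x a : g) u) (adP y y' (x' a : g) v) := by
    intro i u v hu
    rw [sum_wedgeTwo_bracket_frameProj hinv hy.toIsFrame, ← Finset.sum_neg_distrib]
    refine Finset.sum_congr rfl fun a _ => ?_
    rw [frameProj_bracket_comm hu (coe_mem_part (hx.mem a)), map_neg, map_smul, LinearMap.neg_apply,
      LinearMap.smul_apply]
  rw [nu_apply]
  simp_rw [h1, map_sub, map_smul, LinearMap.sub_apply, LinearMap.smul_apply,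
    Finset.sum_sub_distrib, ← Finset.smul_sum, h2 _ hu, h2 _ hv]
  module

/-- The element `φ² + ∑ₐ ν(xₐ) ν(xᵃ)`. -/
def spinScalar (x x' : J → r) (par : K → ZMod 2) (y y' : K → perp β r) : CliffordP β r :=
  cubic β r par y y' * cubic β r par y y' +
    ∑ a, spin y y' (x a : g) * spin y y' (x' a : g)

/-- The element φ has even parity but odd degree, so the Leibniz rule turns φ² into a commutator
with φ. -/
theorem contract_spinScalar (hinv : β.IsInvariant) (hx : (β.restrict r).IsHomFrame parx x x')
    (hy : (β.restrict (perp β r)).IsHomFrame par y y') {k : ZMod 2} {v : perp β r}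
    (hv : v ∈ (part k : Submodule ℂ (perp β r))) :
    contract _ (β.restrict (perp β r)) v (spinScalar x x' par y y') =
      spin y y' (v : g) * cubic β r par y y' - cubic β r par y y' * spin y y' (v : g) -
      (1 / 2 : ℂ) • ∑ a, (ksign (parx a) k •
          (ιP β r (adP y y' (x a : g) v) * spin y y' (x' a : g)) +
        spin y y' (x a : g) * ιP β r (adP y y' (x' a : g) v)) := by
  have h1 : ∀ a, contract _ (β.restrict (perp β r)) v
      (spin y y' (x a : g) * spin y y' (x' a : g)) = -((1 / 2 : ℂ) • (ksign (parx a) k •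
          (ιP β r (adP y y' (x a : g) v) * spin y y' (x' a : g)) +
        spin y y' (x a : g) * ιP β r (adP y y' (x' a : g) v))) := by
    intro a
    rw [(isBihom_spin hinv hy (coe_mem_part (hx.mem a))).contract_mul _ hv,
      contract_spin hinv hy (coe_mem_part (hx.mem a)) hv,
      contract_spin hinv hy (coe_mem_part (hx.mem' a)) hv]
    simp only [neg_mul, mul_neg, smul_mul_assoc, mul_smul_comm]
    rw [ksign_comm k]
    have := congrArg (fun c : ℂ => c •
      (spin y y' (x a : g) * ιP β r (adP y y' (x' a : g) v))) (ksign_mul_self (parx a) k)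
    linear_combination (norm := module) -(1 / 2 : ℂ) • this
  rw [spinScalar, map_add, map_sum, (isBihom_cubic hy).contract_mul _ hv, contract_cubic hinv hy hv]
  simp_rw [h1]
  rw [Finset.sum_neg_distrib, ← Finset.smul_sum, ksign_zero_right]
  module

/-- For different parities both sides vanish; for equal ones, exchange xₐ with xᵃ. This cancels the
scalars that appear when products of vectors are replaced by wedges in the double contraction. -/
theorem sum_ksign_apply_adP_adP (hx : (β.restrict r).IsHomFrame parx x x')
    (hy : (β.restrict (perp β r)).IsHomFrame par y y') {i j : ZMod 2} {u v : perp β r}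
    (hu : u ∈ (part i : Submodule ℂ (perp β r))) (hv : v ∈ (part j : Submodule ℂ (perp β r))) :
    ∑ a, ksign (parx a) i * β.toBilin (adP y y' (x a : g) u : g) (adP y y' (x' a : g) v : g) =
    ksign i j * ∑ a, ksign (parx a) j *
      β.toBilin (adP y y' (x a : g) v : g) (adP y y' (x' a : g) u : g) := by
  have ha := fun (a : J) => adP_mem hy (coe_mem_part (hx.mem a)) hu
  have hb := fun (a : J) => adP_mem hy (coe_mem_part (hx.mem' a)) hv
  have hc := fun (a : J) => adP_mem hy (coe_mem_part (hx.mem a)) hv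
  have hd := fun (a : J) => adP_mem hy (coe_mem_part (hx.mem' a)) hu
  rcases eq_or_ne i j with rfl | e
  · have h1 := hx.sum_swap fun k => ksign k i • ((β.restrict (perp β r)).toBilin.compl₁₂
      (LinearMap.applyₗ u ∘ₗ adP y y' ∘ₗ r.subtype) (LinearMap.applyₗ v ∘ₗ adP y y' ∘ₗ r.subtype))
    simp only [LinearMap.smul_apply, LinearMap.compl₁₂_apply, LinearMap.comp_apply,
      LinearMap.applyₗ_apply_apply, SuperForm.restrict_apply, Submodule.subtype_apply,
      smul_eq_mul] at h1
    rw [h1, Finset.mul_sum]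
    refine Finset.sum_congr rfl fun a _ => ?_
    rw [β.apply_comm_left (coe_mem_part (hd a))]
    rcases zmod2_cases i with e | e <;> rcases zmod2_cases (parx a) with e' | e' <;>
      simp [e, e', CharTwo.add_self_eq_zero]
  · have h0 : ∀ a, parx a + i ≠ parx a + j := fun a h => e (add_left_cancel h)
    rw [Finset.sum_eq_zero, Finset.sum_eq_zero, mul_zero]
    · intro a _
      rw [β.apply_eq_zero (h0 a).symm (coe_mem_part (hc a)) (coe_mem_part (hd a)), mul_zero]
    · intro a _
      rw [β.apply_eq_zero (h0 a) (coe_mem_part (ha a)) (coe_mem_part (hb a)), mul_zero]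

theorem sum_apply_adP_smul_spin (hinv : β.IsInvariant)
    (hx : (β.restrict r).IsHomFrame parx x x') (hy : (β.restrict (perp β r)).IsHomFrame par y y')
    {k : ZMod 2} {v : perp β r} (hv : v ∈ (part k : Submodule ℂ (perp β r))) (z : perp β r) :
    ∑ a, ksign (parx a) k • (β.toBilin (z : g) (adP y y' (x a : g) v : g) •
      spin y y' (x' a : g)) =
    -spin y y' (frameProj β x x' (bracket (z : g) (v : g)) : g) := by
  have h1 := hx.sum_apply' (spin y y' ∘ₗ r.subtype) (frameProj β x x' (bracket (z : g) (v : g)))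
  simp only [LinearMap.comp_apply, Submodule.subtype_apply] at h1
  rw [← h1, ← Finset.sum_neg_distrib]
  refine Finset.sum_congr rfl fun a _ => ?_
  rw [SuperForm.restrict_apply, frameProj_apply_left hx.toIsFrame, hinv, apply_adP hy.toIsFrame,
    bracket_skew _ _ _ (coe_mem_part (hx.mem a)) _ (coe_mem_part hv), map_neg, map_smul, smul_smul,
    smul_eq_mul, mul_neg, ← mul_assoc, ksign_mul_self, one_mul, neg_smul]

theorem sum_apply_adP_smul_spin' (hinv : β.IsInvariant)
    (hx : (β.restrict r).IsHomFrame parx x x') (hy : (β.restrict (perp β r)).IsHomFrame par y y')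
    {k l : ZMod 2} {v z : perp β r} (hv : v ∈ (part k : Submodule ℂ (perp β r)))
    (hz : z ∈ (part l : Submodule ℂ (perp β r))) :
    ∑ a, ksign (parx a) l • (β.toBilin (z : g) (adP y y' (x' a : g) v : g) •
      spin y y' (x a : g)) =
    -spin y y' (frameProj β x x' (bracket (z : g) (v : g)) : g) := by
  have hw := frameProj_mem hx (bracket_mem _ _ _ (coe_mem_part hz) _ (coe_mem_part hv))
  have h1 := hx.sum_apply_par hw fun a =>
    (ksign a l * ksign a k * ksign a a) • (spin y y' ∘ₗ r.subtype)
  have h2 : ksign (l + k) l * ksign (l + k) k * ksign (l + k) (l + k) = 1 := by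
    rcases zmod2_cases k with e | e <;> rcases zmod2_cases l with e' | e' <;>
      simp [e, e', CharTwo.add_self_eq_zero]
  simp only [LinearMap.smul_apply, LinearMap.comp_apply, Submodule.subtype_apply, h2,
    one_smul] at h1
  rw [← h1, ← Finset.sum_neg_distrib]
  refine Finset.sum_congr rfl fun a _ => ?_
  rw [SuperForm.restrict_apply, apply_frameProj hx.toIsFrame, apply_adP hy.toIsFrame,
    bracket_skew _ _ _ (coe_mem_part (hx.mem' a)) _ (coe_mem_part hv), map_neg, map_smul, ← hinv,
    β.apply_comm_right (coe_mem_part (hx.mem' a)), smul_eq_mul]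
  module

theorem contract_contract_spinScalar (hinv : β.IsInvariant)
    (hx : (β.restrict r).IsHomFrame parx x x') (hy : (β.restrict (perp β r)).IsHomFrame par y y')
    {k l : ZMod 2} {v z : perp β r} (hv : v ∈ (part k : Submodule ℂ (perp β r)))
    (hz : z ∈ (part l : Submodule ℂ (perp β r))) :
    contract _ (β.restrict (perp β r)) z
      (contract _ (β.restrict (perp β r)) v (spinScalar x x' par y y')) = 0 := by
  have hp := adP_mem hy (coe_mem_part hv) hz
  have hvφ := (isBihom_spin hinv hy (coe_mem_part hv)).contract_mul (β.restrict (perp β r)) hz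
    (cubic β r par y y')
  have hφv := (isBihom_cubic hy).contract_mul (β.restrict (perp β r)) hz (spin y y' (v : g))
  -- The contraction of [`spin v`, φ] leaves an anticommutator of φ with the vector [v, z]_p, which
  -- equals 2 `spin` of that vector.
  have hφp := (isBihom_cubic hy).two_smul_contract hp
  rw [contract_spin hinv hy (coe_mem_part hv) hz, contract_cubic hinv hy hz] at hvφ hφv
  rw [contract_cubic hinv hy hp] at hφp
  have h3 : ∀ a, contract _ (β.restrict (perp β r)) z (ksign (parx a) k •
        (ιP β r (adP y y' (x a : g) v) * spin y y' (x' a : g)) +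
      spin y y' (x a : g) * ιP β r (adP y y' (x' a : g) v)) =
      ksign (parx a) k • (β.toBilin (z : g) (adP y y' (x a : g) v : g) • spin y y' (x' a : g)) +
      ksign (parx a) l • (β.toBilin (z : g) (adP y y' (x' a : g) v : g) • spin y y' (x a : g)) +
      (1 / 2 * ksign k l : ℂ) • (ksign (parx a) k •
        (ιP β r (adP y y' (x a : g) v) * ιP β r (adP y y' (x' a : g) z))) -
      (1 / 2 : ℂ) • (ksign (parx a) l •
        (ιP β r (adP y y' (x a : g) z) * ιP β r (adP y y' (x' a : g) v))) := by
    intro a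
    rw [map_add, map_smul,
      contract_ι_mul _ _ hz (adP_mem hy (coe_mem_part (hx.mem a)) hv),
      (isBihom_spin hinv hy (coe_mem_part (hx.mem a))).contract_mul _ hz,
      contract_spin hinv hy (coe_mem_part (hx.mem a)) hz,
      contract_spin hinv hy (coe_mem_part (hx.mem' a)) hz, contract_ι, ksign_add_right,
      ksign_comm l, ksign_comm l]
    simp only [neg_mul, mul_neg, smul_mul_assoc, mul_smul_comm, mul_one, SuperForm.restrict_apply]
    have := congrArg (fun c : ℂ => (1 / 2 * ksign k l * ksign (parx a) k * c) •
      (ιP β r (adP y y' (x a : g) v) * ιP β r (adP y y' (x' a : g) z)))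
        (ksign_mul_self (parx a) l)
    linear_combination (norm := module) this
  have hM : ∀ {k : ZMod 2} (v z : perp β r), ∑ a, ksign (parx a) k •
        (ιP β r (adP y y' (x a : g) v) * ιP β r (adP y y' (x' a : g) z)) =
      ∑ a, ksign (parx a) k • wedgeTwo (β.restrict (perp β r))
        (adP y y' (x a : g) v) (adP y y' (x' a : g) z) +
      (∑ a, ksign (parx a) k * β.toBilin (adP y y' (x a : g) v : g)
        (adP y y' (x' a : g) z : g)) • (1 : CliffordP β r) := by
    intro k v z
    rw [Finset.sum_smul, ← Finset.sum_add_distrib]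
    refine Finset.sum_congr rfl fun a _ => ?_
    rw [wedgeTwo_eq, SuperForm.restrict_apply]
    module
  have hc := congrArg (fun c : ℂ => c • (1 : CliffordP β r))
    (sum_ksign_apply_adP_adP hx hy hv hz)
  have hcurv := nu_adP_curvature hinv hx hy hv hz
  rw [map_sub, ← nu_commutator hy (isSkew_adP hinv hy (coe_mem_part hv))
    (isSkew_adP hinv hy (coe_mem_part hz))] at hcurv
  simp only [← spin_apply] at hcurv
  -- The p-part of `spin [v, z]` matches the contribution of φ, and the r-part that of the Casimir
  -- term.
  have hN := congrArg (spin y y')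
    (frameProj_add_frameProj hx.toIsFrame hy.toIsFrame (bracket (v : g) (z : g)))
  have hR : spin y y' (frameProj β x x' (bracket (z : g) (v : g)) : g) =
      -(ksign k l • spin y y' (frameProj β x x' (bracket (v : g) (z : g)) : g)) := by
    rw [bracket_skew _ _ _ (coe_mem_part hz) _ (coe_mem_part hv), ksign_comm]
    simp
  rw [map_add] at hN
  rw [contract_spinScalar hinv hx hy hv, map_sub, map_sub, map_smul, map_sum, hvφ, hφv]
  simp_rw [h3]
  rw [Finset.sum_sub_distrib, Finset.sum_add_distrib, Finset.sum_add_distrib, ← Finset.smul_sum,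
    ← Finset.smul_sum, sum_apply_adP_smul_spin hinv hx hy hv z,
    sum_apply_adP_smul_spin' hinv hx hy hv hz, hM, hM, hR, ksign_comm l k]
  rw [ksign_zero_right, adP_apply (v : g) z] at hφp
  rw [adP_apply (v : g) z]
  simp only [ksign_zero_right, neg_mul, mul_neg, smul_mul_assoc, mul_smul_comm]
  -- Once this sign is fixed, the goal is a combination of the collected relations with rational
  -- coefficients.
  have hs : ksign k l = 1 ∨ ksign k l = -1 := mul_self_eq_one_iff.1 (ksign_mul_self k l)
  rcases hs with hs | hs <;> rw [hs] at hc hcurv ⊢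
  · linear_combination (norm := module) (1 / 2 : ℂ) • hφp + hcurv - hN - (1 / 4 : ℂ) • hc
  · linear_combination (norm := module) (-1 / 2 : ℂ) • hφp - hcurv + hN + (1 / 4 : ℂ) • hc

theorem spinScalar_eq (hinv : β.IsInvariant) (hx : (β.restrict r).IsHomFrame parx x x')
    (hy : (β.restrict (perp β r)).IsHomFrame par y y') :
    spinScalar x x' par y y' =
      tau _ (spinScalar x x' par y y') • (1 : CliffordP β r) := by
  refine eq_tau_of_contract_eq_zero hy fun k v hv => ?_
  have h1 := eq_tau_of_contract_eq_zero hy fun l z hz =>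
    contract_contract_spinScalar hinv hx hy hv hz
  -- Every term is a product of one factor of odd degree and one of even degree. The involution x ↦
  -- -x negates it but fixes scalars, so the scalar found in `h1` is zero.
  have h2 : twist _ 0 (contract _ (β.restrict (perp β r)) v (spinScalar x x' par y y')) =
      -contract _ (β.restrict (perp β r)) v (spinScalar x x' par y y') := by
    have hs : ∀ w : g, twist _ 0 (spin y y' w) = spin y y' w := fun w =>
      (twist_zero_and_tau_of_mem_extPower (eta_nu_mem _)).1
    have hφ := (isBihom_cubic hy).deg
    rw [contract_spinScalar hinv hx hy hv]
    simp only [map_sub, map_smul, map_sum, map_add, map_mul, hs, hφ, twist_zero_ι, neg_mul, mul_neg,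
      smul_neg, ← neg_add, Finset.sum_neg_distrib, smul_mul_assoc, mul_smul_comm]
    module
  rw [h1, map_smul, map_one] at h2
  rw [h1]
  generalize tau _ (contract _ (β.restrict (perp β r)) v (spinScalar x x' par y y')) = c at h2
  have h3 := congrArg (fun u => (1 / 2 : ℂ) • u) h2
  linear_combination (norm := module) h3

/-! ### The value of the scalar -/

/-- The three exterior factors of the left φ become contractions of the right one. The first gives
`spin`, the second its vector action with factor 1/2, and the third a pairing; hence 1/24 = 1/12 ·
1/2. -/
theorem tau_cubic_mul_cubic (hinv : β.IsInvariant)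
    (hy : (β.restrict (perp β r)).IsHomFrame par y y') :
    tau _ (cubic β r par y y' * cubic β r par y y') = 1 / 24 * ∑ i, ∑ j,
      β.toBilin (adP y y' (y i : g) (y j) : g) (adP y y' (y' j : g) (y' i) : g) := by
  have h1 : ∀ i j, tau _ (wedge (β.restrict (perp β r))
      (adP y y' (y i : g) (y j)) (wedgeTwo (β.restrict (perp β r)) (y' j) (y' i)) *
        cubic β r par y y') = 1 / 2 *
      β.toBilin (adP y y' (y i : g) (y j) : g) (adP y y' (y' j : g) (y' i) : g) := by
    intro i j
    have hb := adP_mem hy (coe_mem_part (hy.mem i)) (hy.mem j)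
    have e : β.toBilin (y' j : g) (adP y y' (adP y y' (y i : g) (y j) : g) (y' i) : g) =
        -(ksign (par i + par j) (par i) * (ksign (par i + par j) (par i + par j) *
          β.toBilin (adP y y' (y i : g) (y j) : g) (adP y y' (y' j : g) (y' i) : g))) := by
      rw [adP_comm hb (hy.mem' i), Submodule.coe_neg, Submodule.coe_smul, map_neg, map_smul,
        apply_adP hy.toIsFrame, ← hinv, β.apply_comm_right (coe_mem_part hb),
        apply_adP hy.toIsFrame]
      rfl
    rw [tau_wedge_mul hb, (IsBihom.wedgeTwo (hy.mem' j) (hy.mem' i)).twist, smul_mul_assoc,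
      map_smul, tau_wedgeTwo_mul (hy.mem' j) (hy.mem' i), contract_cubic hinv hy hb,
      contract_spin hinv hy (coe_mem_part hb) (hy.mem' i), map_neg, map_smul, contract_ι,
      SuperForm.restrict_apply, e, map_neg, map_smul, map_smul, tau_one]
    generalize β.toBilin (adP y y' (y i : g) (y j) : g) (adP y y' (y' j : g) (y' i) : g) = c
    simp only [smul_eq_mul, mul_one]
    rcases zmod2_cases (par i) with e | e <;> rcases zmod2_cases (par j) with e' | e' <;>
      simp [e, e', CharTwo.add_self_eq_zero]
  rw [cubic_eq hy, smul_mul_assoc, ← cubic_eq hy, Finset.sum_mul, map_smul, map_sum]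
  simp_rw [Finset.sum_mul, map_sum, h1, ← Finset.mul_sum]
  rw [smul_eq_mul]
  ring

theorem tau_sum_spin_mul_spin (hinv : β.IsInvariant)
    (hx : (β.restrict r).IsHomFrame parx x x') (hy : (β.restrict (perp β r)).IsHomFrame par y y') :
    tau _ (∑ a, spin y y' (x a : g) * spin y y' (x' a : g)) = 1 / 8 * ∑ a, ∑ i,
      β.toBilin (bracket (x a : g) (y i : g)) (bracket (y' i : g) (x' a : g)) := by
  rw [map_sum, Finset.mul_sum]
  refine Finset.sum_congr rfl fun a _ => ?_
  rw [spin_apply, spin_apply, tau_nu_mul_nu hy (isSkew_adP hinv hy (coe_mem_part (hx.mem a)))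
    (isSkew_adP hinv hy (coe_mem_part (hx.mem' a))), neg_mul, ← mul_neg, ← Finset.sum_neg_distrib]
  congr 1
  refine Finset.sum_congr rfl fun i _ => ?_
  rw [SuperForm.restrict_apply, adP_eq_actP hinv hy.toIsFrame, adP_eq_actP hinv hy.toIsFrame,
    bracket_skew _ _ _ (coe_mem_part (hy.mem' i)) _ (coe_mem_part (hx.mem' a)), ksign_comm (par i)]
  simp [actP]

/-- The supertrace of the Casimir element in the adjoint representation. -/
theorem supertrace_ad_casimir {L : Type*} [AddCommGroup L] [Module ℂ L] [FiniteDimensional ℂ L]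
    [LieSuperalgebra L] {κ : SuperForm L} (hκ : κ.IsInvariant) {I : Type*} [Fintype I]
    {p : I → ZMod 2} {b b' : I → L} (h : κ.IsHomFrame p b b') :
    supertrace (Enveloping.ad L (Enveloping.casimir b b')) =
      ∑ i, ∑ j, κ.toBilin (bracket (b i) (b j)) (bracket (b' j) (b' i)) := by
  have h1 : ∀ i j, κ.toBilin (bracket (b i) (bracket (b' i) (b j))) (b' j) =
      ksign (p i) (p i) * κ.toBilin (bracket (b' i) (b j)) (bracket (b' j) (b i)) := by
    intro i j
    rw [bracket_skew _ _ _ (h.mem i) _ (bracket_mem _ _ _ (h.mem' i) _ (h.mem j)), map_neg,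
      map_smul, LinearMap.neg_apply, LinearMap.smul_apply, hκ,
      bracket_skew _ _ _ (h.mem i) _ (h.mem' j), map_neg, map_smul, ksign_add_right, smul_eq_mul,
      smul_eq_mul]
    linear_combination ksign (p i) (p i) *
      κ.toBilin (bracket (b' i) (b j)) (bracket (b' j) (b i)) * ksign_mul_self (p i) (p j)
  rw [h.supertrace_eq]
  have h2 : ∀ j, κ.toBilin (Enveloping.ad L (Enveloping.casimir b b') (b j)) (b' j) =
      ∑ i, κ.toBilin (bracket (b i) (b j)) (bracket (b' j) (b' i)) := by
    intro j
    -- The sign left over in `h1` is absorbed by exchanging `b` and `b'`.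
    have h3 := h.sum_swap fun _ => κ.toBilin.compl₁₂ (bracket.flip (b j)) (bracket (b' j))
    simp only [LinearMap.compl₁₂_apply, LinearMap.flip_apply, smul_eq_mul] at h3
    rw [h3, Enveloping.casimir, map_sum, LinearMap.sum_apply, map_sum, LinearMap.sum_apply]
    refine Finset.sum_congr rfl fun i _ => ?_
    rw [← h1, map_mul, Enveloping.ad, Enveloping.lift_ι, Enveloping.lift_ι, Module.End.mul_apply]
  simp_rw [h2]
  exact Finset.sum_comm

theorem sum_apply_mul_apply {W : Submodule ℂ g} [IsSuperSubspace W] {I : Type*} [Fintype I]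
    {b b' : I → W} (u v : g) :
    ∑ i, β.toBilin u (b i) * β.toBilin (b' i) v = β.toBilin u (frameProj β b b' v) := by
  rw [frameProj_apply, Submodule.coe_sum, map_sum]
  refine Finset.sum_congr rfl fun i _ => ?_
  rw [Submodule.coe_smul, map_smul, smul_eq_mul, mul_comm]

theorem bracket_mem_perp (hinv : β.IsInvariant) (v : perp β r) (w : r) :
    bracket (v : g) (w : g) ∈ perp β r := by
  have h : ∀ i j, bracket ((proj i v : perp β r) : g) ((proj j w : r) : g) ∈ perp β r := by
    intro i j
    rw [bracket_skew _ _ _ (coe_mem_part (proj_mem i v)) _ (coe_mem_part (proj_mem j w))]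
    exact neg_mem (Submodule.smul_mem _ _ (actP hinv (proj j w) (proj i v)).2)
  rw [← proj_add_proj v, ← proj_add_proj w]
  simp only [Submodule.coe_add, map_add, LinearMap.add_apply]
  exact add_mem (add_mem (h _ _) (h _ _)) (add_mem (h _ _) (h _ _))

theorem casimir_eq_casimir {L : Type*} [AddCommGroup L] [Module ℂ L]
    [LieSuperalgebra L] {κ : SuperForm L} {I I' : Type*} [Fintype I] [Fintype I'] {b b' : I → L}
    {c c' : I' → L} (h : κ.IsFrame b b') (hc : κ.IsFrame c c') :
    Enveloping.casimir b b' = Enveloping.casimir c c' :=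
  h.sum_eq_sum hc ((LinearMap.mul ℂ (Enveloping L)).compl₁₂ (Enveloping.ι L) (Enveloping.ι L))

theorem SuperForm.IsInvariant.restrict (hinv : β.IsInvariant) :
    (β.restrict r).IsInvariant := fun a b c => hinv (a : g) (b : g) (c : g)

/-- The r-component of [yᵢ, yⱼ] is measured by pairings with xₐ, and invariance turns these into
brackets of p with r. The pure p-term therefore hides one more copy of the mixed sum. -/
theorem sum_apply_bracket_perp (hinv : β.IsInvariant)
    (hx : (β.restrict r).IsHomFrame parx x x') (hy : (β.restrict (perp β r)).IsHomFrame par y y') :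
    ∑ i, ∑ j, β.toBilin (bracket (y i : g) (y j : g)) (bracket (y' j : g) (y' i : g)) =
      ∑ i, ∑ j, β.toBilin (adP y y' (y i : g) (y j) : g) (adP y y' (y' j : g) (y' i) : g) +
        ∑ j, ∑ a, β.toBilin (bracket (y j : g) (x a : g)) (bracket (x' a : g) (y' j : g)) := by
  have h1 : ∀ i j, β.toBilin (bracket (y i : g) (y j : g)) (bracket (y' j : g) (y' i : g)) =
      β.toBilin (adP y y' (y i : g) (y j) : g) (adP y y' (y' j : g) (y' i) : g) +
        ∑ a, β.toBilin (y i : g) (bracket (y j : g) (x a : g)) *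
          β.toBilin (bracket (x' a : g) (y' j : g)) (y' i : g) := by
    intro i j
    have h2 := sum_apply_mul_apply (β := β) (b := x) (b' := x') (bracket (y i : g) (y j : g))
      (bracket (y' j : g) (y' i : g))
    have h3 := congrArg (β.toBilin (bracket (y i : g) (y j : g))) (frameProj_add_frameProj
      hx.toIsFrame hy.toIsFrame (bracket (y' j : g) (y' i : g)))
    rw [map_add, ← h2] at h3
    rw [← h3, adP_apply_left hy.toIsFrame, add_comm]
    simp only [hinv _ _ (x _ : g), ← hinv (x' _ : g)]
    rfl
  have h4 : ∀ j a, ∑ i, β.toBilin (y i : g) (bracket (y j : g) (x a : g)) *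
      β.toBilin (bracket (x' a : g) (y' j : g)) (y' i : g) =
      β.toBilin (bracket (y j : g) (x a : g)) (bracket (x' a : g) (y' j : g)) := by
    intro j a
    have h5 := sum_apply_mul_apply (β := β) (b := y) (b' := y') (bracket (y j : g) (x a : g))
      (bracket (x' a : g) (y' j : g))
    rw [apply_frameProj hy.toIsFrame ⟨_, bracket_mem_perp hinv (y j) (x a)⟩] at h5
    rw [← h5]
    refine Finset.sum_congr rfl fun i _ => ?_
    rw [β.apply_comm_left (coe_mem_part (hy.mem i)), β.apply_comm_right (coe_mem_part (hy.mem' i))]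
    linear_combination β.toBilin (bracket (y j : g) (x a : g)) (y i : g) *
      β.toBilin (y' i : g) (bracket (x' a : g) (y' j : g)) * ksign_mul_self (par i) (par i)
  simp_rw [h1, Finset.sum_add_distrib]
  congr 1
  rw [Finset.sum_comm]
  refine Finset.sum_congr rfl fun j _ => ?_
  rw [Finset.sum_comm]
  simp_rw [h4]

/-- In the difference of supertraces the rr-sum cancels. The mixed sum occurs twice directly and
once inside the pp-sum, and 3/24 = 1/8 matches the scalar part of ∑ ν(xₐ)ν(xᵃ). -/
theorem tau_spinScalar [FiniteDimensional ℂ g] (hinv : β.IsInvariant)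
    (hx : (β.restrict r).IsHomFrame parx x x') (hy : (β.restrict (perp β r)).IsHomFrame par y y') :
    tau _ (spinScalar x x' par y y') =
      (1 / 24 : ℂ) * (supertrace (Enveloping.ad g (Enveloping.casimir
          (Sum.elim (fun i => (x i : g)) fun k => (y k : g))
          (Sum.elim (fun i => (x' i : g)) fun k => (y' k : g)))) -
          supertrace (Enveloping.ad r (Enveloping.casimir x x'))) := by
  have hrp : ∑ j, ∑ a, β.toBilin (bracket (y j : g) (x a : g)) (bracket (x' a : g) (y' j : g)) =
      ∑ a, ∑ j, β.toBilin (bracket (x a : g) (y j : g)) (bracket (y' j : g) (x' a : g)) := by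
    rw [Finset.sum_comm]
    refine Finset.sum_congr rfl fun a _ => Finset.sum_congr rfl fun j _ => ?_
    rw [bracket_skew _ _ _ (coe_mem_part (hy.mem j)) _ (coe_mem_part (hx.mem a)),
      bracket_skew _ _ _ (coe_mem_part (hx.mem' a)) _ (coe_mem_part (hy.mem' j)),
      ksign_comm (parx a)]
    simp only [map_neg, map_smul, LinearMap.neg_apply, LinearMap.smul_apply, smul_eq_mul, mul_neg,
      neg_neg]
    rw [← mul_assoc, ksign_mul_self, one_mul]
  have hg := supertrace_ad_casimir hinv (isHomFrame_sumElim hx hy)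
  have hr := supertrace_ad_casimir hinv.restrict hx
  have hp := sum_apply_bracket_perp hinv hx hy
  simp only [Fintype.sum_sum_type, Sum.elim_inl, Sum.elim_inr, Finset.sum_add_distrib] at hg
  rw [hp, hrp] at hg
  have hrr : ∑ i, ∑ j, (β.restrict r).toBilin (bracket (x i) (x j)) (bracket (x' j) (x' i)) =
    ∑ i, ∑ j, β.toBilin (bracket (x i : g) (x j : g)) (bracket (x' j : g) (x' i : g)) := rfl
  rw [hrr] at hr
  rw [spinScalar, map_add, tau_cubic_mul_cubic hinv hy, tau_sum_spin_mul_spin hinv hx hy, hg, hr]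
  ring

end Square

section Main

open SuperClifford LieSuperalgebra

variable {g : Type*} [AddCommGroup g] [Module ℂ g] [LieSuperalgebra g] {β : SuperForm g}
  {r : Submodule ℂ g} [IsLieSubsuperalgebra r] {J K : Type*} [Fintype J] [Fintype K]
  {parx : J → ZMod 2} {x x' : J → r} {par : K → ZMod 2} {y y' : K → perp β r}

/-! ### Existence and uniqueness of the spin map of `r` -/

theorem adP_bracket (hinv : β.IsInvariant) (hy : (β.restrict (perp β r)).IsFrame y y')
    {i j : ZMod 2} {u v : r} (hu : u ∈ (part i : Submodule ℂ r))
    (hv : v ∈ (part j : Submodule ℂ r)) :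
    adP y y' (bracket (u : g) (v : g)) = adP y y' (u : g) ∘ₗ adP y y' (v : g) -
      ksign i j • (adP y y' (v : g) ∘ₗ adP y y' (u : g)) := by
  refine linearMap_ext fun k z hz => ?_
  change adP y y' ((bracket u v : r) : g) z = _
  simp only [LinearMap.sub_apply, LinearMap.smul_apply, LinearMap.comp_apply,
    adP_eq_actP hinv hy]
  ext
  have := jacobi _ _ _ _ (coe_mem_part hu) _ (coe_mem_part hv) _ (coe_mem_part hz)
  simp only [actP, Submodule.coe_sub, Submodule.coe_smul, this]
  exact (add_sub_cancel_right _ _).symm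

theorem isNuStar_spin (hinv : β.IsInvariant)
    (hy : (β.restrict (perp β r)).IsHomFrame par y y') :
    IsNuStar hinv (spin y y' ∘ₗ r.subtype) where
  mem_extPower _ := eta_nu_mem _
  mem_grading _ _ hu := (isBihom_spin hinv hy (coe_mem_part hu)).mem
  map_bracket i j u hu v hv := by
    have h := nu_commutator hy (isSkew_adP hinv hy (coe_mem_part hu))
      (isSkew_adP hinv hy (coe_mem_part hv))
    rw [← adP_bracket hinv hy.toIsFrame hu hv] at h
    exact h.symm
  commutator i j u hu z hz := by
    have h := nu_mul_ι hy (isSkew_adP hinv hy (coe_mem_part hu)) hz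
    rwa [adP_eq_actP hinv hy.toIsFrame] at h

/-- The difference of two solutions super-commutes with p, so all its contractions vanish and it is
a scalar; lying in Λ², it has no scalar part. -/
theorem IsNuStar.unique {hinv : β.IsInvariant} (hy : (β.restrict (perp β r)).IsHomFrame par y y')
    {ν ν' : r →ₗ[ℂ] CliffordP β r} (h : IsNuStar hinv ν) (h' : IsNuStar hinv ν') : ν = ν' := by
  refine linearMap_ext fun i u hu => ?_
  have hmem : eta (β.restrict (perp β r)) (ν u - ν' u) ∈ extPower (perp β r) 2 := by
    rw [map_sub]
    exact sub_mem (h.mem_extPower u) (h'.mem_extPower u)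
  obtain ⟨h1, h2⟩ := twist_zero_and_tau_of_mem_extPower hmem
  have hb : IsBihom i 1 (ν u - ν' u) :=
    ⟨sub_mem (h.mem_grading i u hu) (h'.mem_grading i u hu), by rw [h1, one_smul]⟩
  have h3 := eq_tau_of_contract_eq_zero hy (u := ν u - ν' u) fun k z hz => by
    have h4 := hb.two_smul_contract hz
    have h5 := h.commutator i k u hu z hz
    have h6 := h'.commutator i k u hu z hz
    have h7 : (2 : ℂ) • contract _ (β.restrict (perp β r)) z (ν u - ν' u) = 0 := by
      rw [h4, ksign_comm, mul_one]
      have h8 := congrArg (fun c : ℂ => c • (ιP β r z * (ν u - ν' u))) (ksign_mul_self i k)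
      simp only [mul_sub, sub_mul] at h8 ⊢
      linear_combination (norm := module) -(ksign i k) • (h5 - h6) - h8
    exact (smul_eq_zero.1 h7).resolve_left two_ne_zero
  rwa [h2, zero_smul, sub_eq_zero] at h3

/-! ### The square of the cubic Dirac operator -/

theorem inclC_mul_inclU {i j : ZMod 2} {w : g} {v : CliffordP β r}
    (hw : w ∈ (part i : Submodule ℂ g)) (hv : v ∈ grading (β.restrict (perp β r)) j) :
    inclC β r v * inclU β r (Enveloping.ι g w) =
      ksign i j • (inclU β r (Enveloping.ι g w) * inclC β r v) :=
  includeRight_mul_includeLeft _ _ (mem_monomialPart _ hw) hv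

theorem cubicDirac_eq : cubicDirac β r par y y' =
    ∑ i, inclU β r (Enveloping.ι g (y i : g)) * inclC β r (ιP β r (y' i)) +
      inclC β r (cubic β r par y y') := by
  rw [cubicDirac]
  congr 1
  exact Finset.sum_congr rfl fun i _ =>
    (GradedTensorProduct.tmul_one_mul_one_tmul _ _ (R := ℂ) _ _).symm

theorem sum_apply_bracket_smul_wedgeTwo (hinv : β.IsInvariant)
    (hy : (β.restrict (perp β r)).IsFrame y y') (w : g) :
    ∑ i, ∑ j, β.toBilin w (bracket (y i : g) (y j : g)) •
      wedgeTwo (β.restrict (perp β r)) (y' j) (y' i) = (4 : ℂ) • spin y y' w := by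
  rw [← sum_wedgeTwo_adP]
  refine Finset.sum_congr rfl fun i _ => ?_
  rw [← LinearMap.flip_apply, ← hy.sum_apply']
  refine Finset.sum_congr rfl fun j _ => ?_
  rw [SuperForm.restrict_apply, adP_apply_left hy, hinv]
  rfl

theorem sum_sum_sum_comm {κ M : Type*} [Fintype κ] [AddCommMonoid M] (f : K → K → κ → M) :
    ∑ i, ∑ j, ∑ a, f i j a = ∑ a, ∑ i, ∑ j, f i j a := by
  simp_rw [Finset.sum_comm (s := (Finset.univ : Finset K)) (t := (Finset.univ : Finset κ))]

/-- Expand [yᵢ, yⱼ] in the frame of g = r ⊕ p. The coefficients of each frame vector, summed against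
yʲ ∧ yⁱ, assemble to 4 `spin` of its dual vector. -/
theorem sum_bracket_wedgeTwo {M : Type*} [AddCommGroup M] [Module ℂ M] (hinv : β.IsInvariant)
    (hx : (β.restrict r).IsFrame x x') (hy : (β.restrict (perp β r)).IsFrame y y')
    (B : g →ₗ[ℂ] CliffordP β r →ₗ[ℂ] M) :
    ∑ i, ∑ j, B (bracket (y i : g) (y j : g))
      (wedgeTwo (β.restrict (perp β r)) (y' j) (y' i)) =
    (4 : ℂ) • (∑ a, B (x a : g) (spin y y' (x' a : g)) +
      ∑ k, B (y k : g) (spin y y' (y' k : g))) := by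
  have h1 : ∀ w : g, B w = ∑ a, β.toBilin (x' a : g) w • B (x a : g) +
      ∑ k, β.toBilin (y' k : g) w • B (y k : g) := by
    intro w
    conv_lhs => rw [← frameProj_add_frameProj hx hy w]
    simp only [frameProj_apply, Submodule.coe_sum, Submodule.coe_smul, map_add, map_sum, map_smul]
  have h2 : ∀ w v : g, ∑ i, ∑ j, β.toBilin w (bracket (y i : g) (y j : g)) •
      B v (wedgeTwo (β.restrict (perp β r)) (y' j) (y' i)) =
        (4 : ℂ) • B v (spin y y' w) := by
    intro w v
    rw [← map_smul, ← sum_apply_bracket_smul_wedgeTwo hinv hy w]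
    simp only [map_sum, map_smul]
  have h3 : ∀ i j, B (bracket (y i : g) (y j : g))
      (wedgeTwo (β.restrict (perp β r)) (y' j) (y' i)) =
      ∑ a, β.toBilin (x' a : g) (bracket (y i : g) (y j : g)) •
        B (x a : g) (wedgeTwo (β.restrict (perp β r)) (y' j) (y' i)) +
      ∑ k, β.toBilin (y' k : g) (bracket (y i : g) (y j : g)) •
        B (y k : g) (wedgeTwo (β.restrict (perp β r)) (y' j) (y' i)) := by
    intro i j
    conv_lhs => rw [h1]
    simp only [LinearMap.add_apply, LinearMap.sum_apply, LinearMap.smul_apply]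
  simp_rw [h3, Finset.sum_add_distrib]
  rw [sum_sum_sum_comm, sum_sum_sum_comm]
  simp_rw [h2]
  rw [← Finset.smul_sum, ← Finset.smul_sum, smul_add]

/-- The square of `∑ᵢ yᵢ yⁱ + φ` in an algebra to which `g` and `C(p)` are mapped, such that their
images super-commute. -/
theorem sum_add_cubic_mul_self {A : Type*} [Ring A] [Algebra ℂ A] (hinv : β.IsInvariant)
    (hx : (β.restrict r).IsHomFrame parx x x')
    (hy : (β.restrict (perp β r)).IsHomFrame par y y')
    (u : g →ₗ[ℂ] A) (c : CliffordP β r →ₐ[ℂ] A)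
    (hu : ∀ i j, ∀ a ∈ (part i : Submodule ℂ g), ∀ b ∈ (part j : Submodule ℂ g),
      u a * u b - ksign i j • (u b * u a) = u (bracket a b))
    (hc : ∀ i j, ∀ w ∈ (part i : Submodule ℂ g), ∀ v ∈ grading (β.restrict (perp β r)) j,
      c v * u w = ksign i j • (u w * c v)) :
    (∑ i, u (y i : g) * c (ιP β r (y' i)) + c (cubic β r par y y')) ^ 2 =
      ∑ i, u (y i : g) * u (y' i : g) -
        (2 : ℂ) • ∑ a, u (x a : g) * c (spin y y' (x' a : g)) +
      c (cubic β r par y y' * cubic β r par y y') := by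
  -- Splitting yⁱ yʲ = yⁱ ∧ yʲ + (yⁱ, yʲ), the scalar part contracts one of the two sums.
  have hsq : (∑ i, u (y i : g) * c (ιP β r (y' i))) * (∑ i, u (y i : g) * c (ιP β r (y' i))) =
      ∑ i, u (y i : g) * u (y' i : g) + ∑ i, ∑ j, ksign (par i) (par j) •
        (u (y i : g) * u (y j : g) * c (wedgeTwo (β.restrict (perp β r)) (y' i) (y' j))) := by
    have h1 : ∀ i j, u (y i : g) * c (ιP β r (y' i)) * (u (y j : g) * c (ιP β r (y' j))) =
        (β.restrict (perp β r)).toBilin (y' j) (y' i) • (u (y i : g) * u (y j : g)) +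
        ksign (par i) (par j) •
          (u (y i : g) * u (y j : g) * c (wedgeTwo (β.restrict (perp β r)) (y' i) (y' j))) := by
      intro i j
      rw [(β.restrict (perp β r)).supersymm _ _ _ (hy.mem' j) _ (hy.mem' i), wedgeTwo_eq, map_sub,
        map_smul, map_one, map_mul, mul_assoc, ← mul_assoc (c _) (u _),
        hc _ _ _ (coe_mem_part (hy.mem j)) _ (ι_mem (hy.mem' i)), ksign_comm (par j)]
      simp only [mul_sub, mul_smul_comm, smul_mul_assoc, mul_one, mul_assoc]
      module
    rw [Finset.sum_mul_sum]
    simp_rw [h1, Finset.sum_add_distrib]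
    congr 1
    exact Finset.sum_congr rfl fun i _ =>
      hy.sum_apply (LinearMap.mulLeft ℂ (u (y i : g)) ∘ₗ u ∘ₗ (perp β r).subtype) (y' i)
  -- Averaging with the sum in which i and j are exchanged produces super-commutators, since the
  -- wedge is super-skew.
  have hbr : (2 : ℂ) • ∑ i, ∑ j, ksign (par i) (par j) •
        (u (y i : g) * u (y j : g) * c (wedgeTwo (β.restrict (perp β r)) (y' i) (y' j))) =
      -∑ i, ∑ j, u (bracket (y i : g) (y j : g)) *
        c (wedgeTwo (β.restrict (perp β r)) (y' j) (y' i)) := by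
    rw [two_smul]
    nth_rewrite 2 [Finset.sum_comm]
    rw [← Finset.sum_add_distrib, ← Finset.sum_neg_distrib]
    refine Finset.sum_congr rfl fun i _ => ?_
    rw [← Finset.sum_add_distrib, ← Finset.sum_neg_distrib]
    refine Finset.sum_congr rfl fun j _ => ?_
    rw [← hu _ _ _ (coe_mem_part (hy.mem i)) _ (coe_mem_part (hy.mem j)),
      wedgeTwo_comm (hy.mem' i) (hy.mem' j), ksign_comm (par j), map_neg, map_smul]
    simp only [mul_neg, mul_smul_comm, sub_mul, smul_mul_assoc]
    have h := congrArg (fun t : ℂ => t • (u (y i : g) * u (y j : g) *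
      c (wedgeTwo (β.restrict (perp β r)) (y' j) (y' i)))) (ksign_mul_self (par i) (par j))
    linear_combination (norm := module) -h
  have h4 := sum_bracket_wedgeTwo hinv hx.toIsFrame hy.toIsFrame
    ((LinearMap.mul ℂ A).compl₁₂ u c.toLinearMap)
  simp only [LinearMap.compl₁₂_apply, LinearMap.mul_apply', AlgHom.toLinearMap_apply] at h4
  have hcross : (∑ i, u (y i : g) * c (ιP β r (y' i))) * c (cubic β r par y y') +
      c (cubic β r par y y') * (∑ i, u (y i : g) * c (ιP β r (y' i))) =
      (2 : ℂ) • ∑ k, u (y k : g) * c (spin y y' (y' k : g)) := by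
    rw [Finset.sum_mul, Finset.mul_sum, ← Finset.sum_add_distrib, Finset.smul_sum]
    refine Finset.sum_congr rfl fun k _ => ?_
    have h5 := (isBihom_cubic hy).two_smul_contract (hy.mem' k)
    rw [contract_cubic hinv hy (hy.mem' k), ksign_zero_right] at h5
    rw [← mul_assoc, hc _ _ _ (coe_mem_part (hy.mem k)) _ (isBihom_cubic hy).mem, ksign_zero_right,
      one_smul, mul_assoc, mul_assoc, ← mul_smul_comm, ← mul_add, ← map_mul, ← map_mul, ← map_add,
      ← map_smul, h5]
    congr 2
    module
  rw [pow_two, add_mul, mul_add, mul_add, hsq, map_mul]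
  linear_combination (norm := module) hcross + (1 / 2 : ℂ) • hbr - (1 / 2 : ℂ) • h4

/-- The two mixed sums coincide: the sign from moving ν(xₐ) past xᵃ is the one produced by
exchanging dual frames. -/
theorem zeta_casimir {hinv : β.IsInvariant} (hx : (β.restrict r).IsHomFrame parx x x')
    {ν : r →ₗ[ℂ] CliffordP β r} (hν : IsNuStar hinv ν) :
    zeta hν (Enveloping.casimir x x') =
      ∑ a, inclU β r (Enveloping.ι g (x a : g)) * inclU β r (Enveloping.ι g (x' a : g)) +
        (2 : ℂ) • ∑ a, inclU β r (Enveloping.ι g (x a : g)) * inclC β r (ν (x' a)) +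
        inclC β r (∑ a, ν (x a) * ν (x' a)) := by
  have h1 : ∀ w : r, zeta hν (Enveloping.ι r w) =
      inclU β r (Enveloping.ι g (w : g)) + inclC β r (ν w) := fun w =>
    Enveloping.lift_ι _ _ w
  have h2 := hx.sum_swap fun _ => (LinearMap.mul ℂ (DiracAlgebra β r)).compl₁₂
    ((inclU β r).toLinearMap ∘ₗ Enveloping.ι g ∘ₗ r.subtype) ((inclC β r).toLinearMap ∘ₗ ν)
  simp only [LinearMap.compl₁₂_apply, LinearMap.mul_apply', AlgHom.toLinearMap_apply,
    LinearMap.comp_apply, Submodule.subtype_apply] at h2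
  have h3 : ∀ a, inclC β r (ν (x a)) * inclU β r (Enveloping.ι g (x' a : g)) =
      ksign (parx a) (parx a) •
        (inclU β r (Enveloping.ι g (x' a : g)) * inclC β r (ν (x a))) := fun a =>
    inclC_mul_inclU (coe_mem_part (hx.mem' a)) (hν.mem_grading _ _ (hx.mem a))
  rw [Enveloping.casimir, map_sum, map_sum, two_smul]
  conv_rhs => enter [1, 2, 2]; rw [h2]
  rw [← Finset.sum_add_distrib, ← Finset.sum_add_distrib, ← Finset.sum_add_distrib]
  refine Finset.sum_congr rfl fun a _ => ?_
  rw [map_mul, h1, h1, map_mul, add_mul, mul_add, mul_add, h3]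
  abel

end Main

end SuperDirac
end

/-! ### The theorem -/

open SuperDirac GradedTensorProduct in
theorem theorem5p1 {g : Type*} [AddCommGroup g] [Module ℂ g] [FiniteDimensional ℂ g]
    [LieSuperalgebra g] (β : SuperForm g) (hβ : β.toBilin.Nondegenerate) (hinv : β.IsInvariant)
    (r : Submodule ℂ g) [IsLieSubsuperalgebra r] (hr : (β.toBilin.restrict r).Nondegenerate)
    {I J K : Type*} [Fintype I] [DecidableEq I] [Fintype J] [DecidableEq J]
    [Fintype K] [DecidableEq K]
    (e : Module.Basis I ℂ g) (e' : I → g) (he : β.IsDual e e')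
    (x : Module.Basis J ℂ r) (x' : J → r) (hx : (β.restrict r).IsDual x x')
    (y : Module.Basis K ℂ (perp β r)) (y' : K → perp β r)
    (hy : (β.restrict (perp β r)).IsDual y y')
    (par : K → ZMod 2) (hpar : ∀ k, y k ∈ (part (par k) : Submodule ℂ (perp β r))) :
    (∃! ν : r →ₗ[ℂ] CliffordP β r, IsNuStar hinv ν) ∧
    ∀ (ν : r →ₗ[ℂ] CliffordP β r) (hν : IsNuStar hinv ν),
      cubicDirac β r par y y' ^ 2 =
        tmul ℂ (Enveloping.casimir e e') 1 - zeta hν (Enveloping.casimir x x') +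
        ((1 / 24 : ℂ) * (supertrace (Enveloping.ad g (Enveloping.casimir e e')) -
          supertrace (Enveloping.ad r (Enveloping.casimir x x')))) • tmul ℂ 1 1 := by
  have hyf : (β.restrict (perp β r)).IsHomFrame par y y' := .of_isDual hy hpar
  have hν₀ := isNuStar_spin hinv hyf
  refine ⟨⟨_, hν₀, fun ν hν => hν.unique hyf hν₀⟩, fun ν hν => ?_⟩
  obtain rfl := hν.unique hyf hν₀
  -- The given bases of r and g need not be homogeneous. Casimir elements do not depend on the dual
  -- frames, so a homogeneous frame of r, joined with that of p, replaces them.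
  obtain ⟨n, parz, z, z', hz⟩ := (β.restrict r).exists_isHomFrame hr
  rw [casimir_eq_casimir (.of_isDual hx) hz.toIsFrame,
    casimir_eq_casimir (.of_isDual he) (isHomFrame_sumElim hz hyf).toIsFrame,
    ← tau_spinScalar hinv hz hyf, zeta_casimir hz]
  have hsq := sum_add_cubic_mul_self hinv hz hyf ((inclU β r).toLinearMap ∘ₗ Enveloping.ι g)
    (inclC β r)
    (fun i j a ha b hb => by
      have h := congrArg (inclU β r) (Enveloping.ι_rel ha hb)
      rwa [map_sub, map_smul, map_mul, map_mul] at h)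
    (fun i j w hw v hv => inclC_mul_inclU hw hv)
  have hscal := congrArg (inclC β r) (spinScalar_eq hinv hz hyf)
  rw [map_smul, map_one, spinScalar, map_add] at hscal
  have hcas : inclU β r (Enveloping.casimir (Sum.elim (fun i => (z i : g)) fun k => (y k : g))
      (Sum.elim (fun i => (z' i : g)) fun k => (y' k : g))) =
      ∑ i, inclU β r (Enveloping.ι g (z i : g)) * inclU β r (Enveloping.ι g (z' i : g)) +
        ∑ k, inclU β r (Enveloping.ι g (y k : g)) * inclU β r (Enveloping.ι g (y' k : g)) := by
    rw [Enveloping.casimir, map_sum, Fintype.sum_sum_type]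
    simp only [map_mul, Sum.elim_inl, Sum.elim_inr]
  rw [cubicDirac_eq]
  refine hsq.trans ?_
  change _ = inclU β r _ - _ + _ • (1 : DiracAlgebra β r)
  rw [hcas]
  simp only [LinearMap.comp_apply, AlgHom.toLinearMap_apply, Submodule.subtype_apply]
  rw [spinScalar]
  -- All terms involving U(g) have cancelled; what remains is that φ² + ∑ ν(zₐ)ν(zᵃ) is its scalar
  -- part.
  linear_combination (norm := module) hscal
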